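/- For a smooth closed immersed plane curve $\gamma$ with arclength parameter $s$, unit tangent $\tau=\gamma_s$, unit normal $\nu$ ($\tau$ rotated by $+\pi/2$) and curvature scalar $k=\tau_s\cdot\nu$, let $L=\int \mathrm ds$ be the length, $\frac1{2\pi}\int k\,\mathrm ds$ the turning number, $\bar k=\frac1L\int k\,\mathrm ds$, $\|k_s\|_2^2=\int k_s^2\,\mathrm ds$ and $$K_{\mathrm{osc}}=L\int (k-\bar k)^2\,\mathrm ds .$$ The rescaled free elastic flow is the evolution equation $$\partial_t\gamma=-\bigl(2k_{ss}+k^3-\lambda(t)\,(\gamma\cdot\nu)\bigr)\nu,\qquad \lambda(t)=\frac1{L(t)}\Bigl(2\int k_s^2\,\mathrm ds-\int k^4\,\mathrm ds\Bigr).$$ **Proposition.** For every integer $\omega\ge 1$ there are $\varepsilon_0=\varepsilon_0(\omega)>0$ and $t_0=t_0(\omega)\ge 0$ with the following property. Let $\gamma:\mathbb S^1\times[0,T)\to\mathbb R^2$, $T\in(0,\infty]$, be a smooth solution (up to and including $t=0$) of the rescaled free elastic flow through closed immersed plane curves, whose initial curve $\gamma_0=\gamma(\cdot,0)$ has turning number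 $\omega$, length $L(0)=2\pi\omega$, and satisfies $$K_{\mathrm{osc}}(\gamma_0)\le\varepsilon_0 .$$ Then for all $t\in(t_0,T)$, $$\|k_s\|_2^2(t)\;\le\;\|k_s\|_2^2(t_0)\;e^{-\frac{1}{4\omega^4}t}.$$ -/

import Mathlib

noncomputable section

namespace FreeElastic

open scoped ContDiff

/-! The plane is `ℂ` with its real inner product. A closed curve is a `2π`-periodic map
`c : ℝ → ℂ` of a parameter `u`; multiplication by `Complex.I` is the rotation by `+π/2`. -/

/-- The length element `|c'(u)|`, so that `ds = speed c u du`. -/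
def speed (c : ℝ → ℂ) (u : ℝ) : ℝ := ‖deriv c u‖

/-- The derivative `f_s = |c'|⁻¹ f_u` with respect to the arclength of `c`. -/
def arcDeriv {E : Type*} [NormedAddCommGroup E] [NormedSpace ℝ E]
    (c : ℝ → ℂ) (f : ℝ → E) (u : ℝ) : E :=
  (speed c u)⁻¹ • deriv f u

/-- The integral `∫ f ds` over one period of `c`. -/
def arcIntegral (c : ℝ → ℂ) (f : ℝ → ℝ) : ℝ :=
  ∫ u in (0 : ℝ)..(2 * Real.pi), f u * speed c u

/-- The unit tangent `τ = c_s`. -/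
def tangent (c : ℝ → ℂ) (u : ℝ) : ℂ := arcDeriv c c u

/-- The unit normal `ν`, the tangent rotated by `+π/2` (inward on a positively oriented circle). -/
def normal (c : ℝ → ℂ) (u : ℝ) : ℂ := Complex.I * tangent c u

/-- The curvature scalar `k = τ_s · ν`, positive on positively oriented circles. -/
def curvature (c : ℝ → ℂ) (u : ℝ) : ℝ := inner ℝ (arcDeriv c (tangent c) u) (normal c u)

/-- The length `L = ∫ ds`. -/
def length (c : ℝ → ℂ) : ℝ := arcIntegral c (fun _ => 1)

/-- The turning number `(1 / 2π) ∫ k ds`. -/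
def turningNumber (c : ℝ → ℂ) : ℝ := (2 * Real.pi)⁻¹ * arcIntegral c (curvature c)

/-- The mean curvature `k̄ = (1 / L) ∫ k ds`. -/
def meanCurvature (c : ℝ → ℂ) : ℝ := (length c)⁻¹ * arcIntegral c (curvature c)

/-- The normalised oscillation of curvature `K_osc = L ∫ (k - k̄)² ds`. -/
def Kosc (c : ℝ → ℂ) : ℝ :=
  length c * arcIntegral c (fun u => (curvature c u - meanCurvature c) ^ 2)

/-- The first arclength derivative `k_s` of the curvature. -/
def curvatureS (c : ℝ → ℂ) (u : ℝ) : ℝ := arcDeriv c (curvature c) u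

/-- The second arclength derivative `k_ss` of the curvature. -/
def curvatureSS (c : ℝ → ℂ) (u : ℝ) : ℝ := arcDeriv c (curvatureS c) u

/-- `‖k_s‖₂² = ∫ k_s² ds`. -/
def ksNormSq (c : ℝ → ℂ) : ℝ := arcIntegral c (fun u => curvatureS c u ^ 2)

/-- The rescaling factor `λ = (1 / L) (2 ∫ k_s² ds - ∫ k⁴ ds)`. -/
def rescalingFactor (c : ℝ → ℂ) : ℝ :=
  (length c)⁻¹ * (2 * ksNormSq c - arcIntegral c (fun u => curvature c u ^ 4))

/-- The velocity `-(2 k_ss + k³ - λ (c · ν)) ν` of the rescaled free elastic flow. -/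
def velocity (c : ℝ → ℂ) (u : ℝ) : ℂ :=
  (-(2 * curvatureSS c u + curvature c u ^ 3
      - rescalingFactor c * inner ℝ (c u) (normal c u))) • normal c u

/-- The time interval `[0, T)`, where `T = ⊤` is allowed. -/
def timeInterval (T : EReal) : Set ℝ := {t : ℝ | 0 ≤ t ∧ (t : EReal) < T}

/-- `γ`, with `γ t` the curve at time `t`, is a smooth solution on `[0, T)`, up to and including
the initial time, of the rescaled free elastic flow of closed immersed plane curves. -/
structure IsRescaledFlow (T : EReal) (γ : ℝ → ℝ → ℂ) : Prop where
  smooth : ContDiffOn ℝ ∞ (fun p : ℝ × ℝ => γ p.1 p.2) (timeInterval T ×ˢ Set.univ)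
  closed : ∀ t ∈ timeInterval T, Function.Periodic (γ t) (2 * Real.pi)
  immersed : ∀ t ∈ timeInterval T, ∀ u : ℝ, deriv (γ t) u ≠ 0
  evolution : ∀ t ∈ timeInterval T, ∀ u : ℝ,
    HasDerivWithinAt (fun r => γ r u) (velocity (γ t) u) (timeInterval T) t

end FreeElastic

end

/-!
The proof takes `t₀ = 0`. A positive `t₀` would not do for a flow that exists beyond `t₀` with
`k_s ≠ 0` at that time: as `t ↓ t₀`, the claim would read
`‖k_s‖₂²(t₀) ≤ ‖k_s‖₂²(t₀) exp (-t₀ / (4 ω⁴))`.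

For a normal variation `∂_t γ = V ν` one has `∂_t ds = -k V ds`, `∂_t k = V_ss + k² V` and
`∂_t ∂_s = ∂_s ∂_t + k V ∂_s` (`IsNormalVariation.hasDerivAt_speed`, `hasDerivAt_curvature`,
`hasDerivAt_arcDeriv`). Along the rescaled flow the length and the total curvature are therefore
constant, so that `L = 2πω` and `k̄ = 1` for all time. Integration by parts yields
* `d/dt ∫ k² = ∫ (-4 k_ss² + 12 k² k_s² - k⁶ - λ k²)`,
* `d/dt ∫ k_s² = ∫ (-4 k_sss² + 10 k² k_ss² - (10/3) k_s⁴ - 11 k⁴ k_s² - 3 λ k_s²)`.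

With `k = 1 + f` and `λ` close to `-1`, the quadratic parts of the right-hand sides are
`-4 ‖f_ss‖² + 10 ‖f_s‖² - 8 ‖f‖²` and `-4 ‖f_sss‖² + 10 ‖f_ss‖² - 8 ‖f_s‖²`. Since
`‖f_s‖² ≤ ‖f‖ ‖f_ss‖` (and the same one derivative higher) and `10² < 4 · 4 · 8`, both are negative
definite; no sharp Poincaré inequality is needed. Of the other terms, those without a favourable
sign are bounded by interpolation, by `‖f‖` times a power of `L` times terms already controlled
(`Interpolation.energy_form_le`, `Interpolation.energy_form_deriv_le`). They are absorbed once `‖f‖`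
is small, however large `‖f_s‖` may be. The first inequality then shows that `‖f‖`, that is
`K_osc`, remains small
(`IsRescaledFlow.sqrt_arcIntegral_curvature_sub_one_sq_le`), and the second one gives
`d/dt ‖k_s‖² ≤ -‖k_s‖² / 2`, which is more than the rate `1 / (4 ω⁴) ≤ 1 / 4`.
-/

noncomputable section

namespace FreeElastic

open scoped ContDiff Topology
open Set

/-! ### Smooth families of functions of one variable -/

section Families

variable {E : Type*} [NormedAddCommGroup E] [NormedSpace ℝ E]

/-- The two-parameter family `F t u` is jointly smooth for times `t ∈ J` and all parameters `u`,
up to the boundary points of `J` that belong to `J`. -/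
def SmoothOnStrip (J : Set ℝ) (F : ℝ → ℝ → E) : Prop :=
  ContDiffOn ℝ ∞ (fun p : ℝ × ℝ => F p.1 p.2) (J ×ˢ univ)

namespace SmoothOnStrip

variable {J : Set ℝ} {F : ℝ → ℝ → E}

theorem mono (hF : SmoothOnStrip J F) {J' : Set ℝ} (h : J' ⊆ J) : SmoothOnStrip J' F :=
  ContDiffOn.mono hF (prod_mono h subset_rfl)

theorem congr (hF : SmoothOnStrip J F) {G : ℝ → ℝ → E} (h : ∀ t ∈ J, ∀ u, G t u = F t u) :
    SmoothOnStrip J G :=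
  ContDiffOn.congr hF fun p hp => h p.1 hp.1 p.2

theorem contDiff (hF : SmoothOnStrip J F) {t : ℝ} (ht : t ∈ J) : ContDiff ℝ ∞ (F t) :=
  contDiffOn_univ.1 (ContDiffOn.comp hF (g := fun p : ℝ × ℝ => F p.1 p.2)
    (f := fun u => (t, u)) (by fun_prop) fun u _ => ⟨ht, mem_univ u⟩)

theorem deriv_param (hF : SmoothOnStrip J F) (hJ : UniqueDiffOn ℝ J) :
    SmoothOnStrip J fun t u => deriv (F t) u := by
  have hU : UniqueDiffOn ℝ (J ×ˢ (univ : Set ℝ)) := hJ.prod uniqueDiffOn_univ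
  have h1 := (ContDiffOn.fderivWithin hF hU (m := ∞) (by simp)).clm_apply
    (contDiffOn_const (c := ((0 : ℝ), (1 : ℝ))))
  refine ContDiffOn.congr h1 fun p hp => ?_
  have h2 : HasFDerivWithinAt (fun p : ℝ × ℝ => F p.1 p.2) _ (J ×ˢ univ) (p.1, p.2) :=
    ((ContDiffOn.differentiableOn hF (by simp)) p hp).hasFDerivWithinAt
  have h3 : HasDerivWithinAt (fun u : ℝ => (p.1, u)) ((0 : ℝ), (1 : ℝ)) univ p.2 :=
    ((hasDerivAt_const p.2 p.1).prodMk (hasDerivAt_id p.2)).hasDerivWithinAt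
  exact (hasDerivWithinAt_univ.1
    (h2.comp_hasDerivWithinAt p.2 h3 fun u _ => ⟨hp.1, mem_univ u⟩)).deriv

section Open

variable (hJ : IsOpen J) (hF : SmoothOnStrip J F)
include hJ hF

theorem contDiffAt {t : ℝ} (ht : t ∈ J) (u : ℝ) :
    ContDiffAt ℝ ∞ (fun p : ℝ × ℝ => F p.1 p.2) (t, u) :=
  ContDiffOn.contDiffAt hF ((hJ.prod isOpen_univ).mem_nhds ⟨ht, mem_univ u⟩)

theorem hasDerivAt_time_fderiv {t : ℝ} (ht : t ∈ J) (u : ℝ) :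
    HasDerivAt (fun r => F r u) (fderiv ℝ (fun p : ℝ × ℝ => F p.1 p.2) (t, u) (1, 0)) t :=
  ((contDiffAt hJ hF ht u).differentiableAt (by simp)).hasFDerivAt.comp_hasDerivAt
    (f := fun r => (r, u)) t ((hasDerivAt_id t).prodMk (hasDerivAt_const t u))

theorem hasDerivAt_param_fderiv {t : ℝ} (ht : t ∈ J) (u : ℝ) :
    HasDerivAt (F t) (fderiv ℝ (fun p : ℝ × ℝ => F p.1 p.2) (t, u) (0, 1)) u :=
  ((contDiffAt hJ hF ht u).differentiableAt (by simp)).hasFDerivAt.comp_hasDerivAt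
    (f := fun w => (t, w)) u ((hasDerivAt_const u t).prodMk (hasDerivAt_id u))

theorem hasDerivAt_time {t : ℝ} (ht : t ∈ J) (u : ℝ) :
    HasDerivAt (fun r => F r u) (deriv (fun r => F r u) t) t :=
  (hasDerivAt_time_fderiv hJ hF ht u).differentiableAt.hasDerivAt

theorem deriv_time : SmoothOnStrip J fun t u => deriv (fun r => F r u) t :=
  ContDiffOn.congr
    ((ContDiffOn.fderiv_of_isOpen hF (hJ.prod isOpen_univ) (m := ∞) (by simp)).clm_apply
      (contDiffOn_const (c := ((1 : ℝ), (0 : ℝ))))) fun p hp =>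
    (hasDerivAt_time_fderiv hJ hF hp.1 p.2).deriv

/-- Time and parameter derivatives commute. -/
theorem hasDerivAt_deriv_param {t : ℝ} (ht : t ∈ J) (u : ℝ) {G : ℝ → E}
    (hG : ∀ w, HasDerivAt (fun r => F r w) (G w) t) :
    HasDerivAt (fun r => deriv (F r) u) (deriv G u) t := by
  set Φ : ℝ × ℝ → E := fun p => F p.1 p.2
  have hd : HasFDerivAt (fderiv ℝ Φ) (fderiv ℝ (fderiv ℝ Φ) (t, u)) (t, u) :=
    (((contDiffAt hJ hF ht u).fderiv_right (m := ∞) (by simp)).differentiableAt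
      (by simp)).hasFDerivAt
  have h1 : HasDerivAt (fun r => fderiv ℝ Φ (r, u) (0, 1))
      (fderiv ℝ (fderiv ℝ Φ) (t, u) (1, 0) (0, 1)) t :=
    (ContinuousLinearMap.apply ℝ E ((0 : ℝ), (1 : ℝ))).hasFDerivAt.comp_hasDerivAt t
      (hd.comp_hasDerivAt (f := fun r => (r, u)) t
        ((hasDerivAt_id t).prodMk (hasDerivAt_const t u)))
  have h2 : HasDerivAt (fun w => fderiv ℝ Φ (t, w) (1, 0))
      (fderiv ℝ (fderiv ℝ Φ) (t, u) (0, 1) (1, 0)) u :=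
    (ContinuousLinearMap.apply ℝ E ((1 : ℝ), (0 : ℝ))).hasFDerivAt.comp_hasDerivAt u
      (hd.comp_hasDerivAt (f := fun w => (t, w)) u
        ((hasDerivAt_const u t).prodMk (hasDerivAt_id u)))
  have hs := (contDiffAt hJ hF ht u).isSymmSndFDerivAt
    (by simpa using WithTop.coe_le_coe.2 (le_top (a := (2 : ℕ∞)))) (1, 0) (0, 1)
  have h3 : G = fun w => fderiv ℝ Φ (t, w) (1, 0) :=
    funext fun w => (hG w).unique (hasDerivAt_time_fderiv hJ hF ht w)
  rw [h3, h2.deriv, ← hs]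
  refine h1.congr_of_eventuallyEq ?_
  filter_upwards [hJ.mem_nhds ht] with r hr
  exact (hasDerivAt_param_fderiv hJ hF hr u).deriv

/-- Differentiation under the integral over a compact parameter interval. -/
theorem hasDerivAt_integral [CompleteSpace E] {t a b : ℝ} (ht : t ∈ J) {G : ℝ → E}
    (hG : ∀ w, HasDerivAt (fun r => F r w) (G w) t) :
    HasDerivAt (fun r => ∫ u in a..b, F r u) (∫ u in a..b, G u) t := by
  set F' : ℝ → ℝ → E := fun t u => deriv (fun r => F r u) t
  have hF' : SmoothOnStrip J F' := deriv_time hJ hF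
  have hGF : G = F' t := funext fun w => (hG w).unique (hasDerivAt_time hJ hF ht w)
  obtain ⟨δ, hδ, hball⟩ := Metric.nhds_basis_closedBall.mem_iff.1 (hJ.mem_nhds ht)
  have hcomp : IsCompact (Metric.closedBall t δ ×ˢ uIcc a b) :=
    (isCompact_closedBall t δ).prod isCompact_uIcc
  obtain ⟨C, hC⟩ := hcomp.exists_bound_of_continuousOn
    ((ContDiffOn.continuousOn hF').mono (prod_mono hball (subset_univ _)))
  rw [hGF]
  refine (intervalIntegral.hasDerivAt_integral_of_dominated_loc_of_deriv_le
    (F' := F') (bound := fun _ => C) (Metric.closedBall_mem_nhds t hδ) ?_ ?_ ?_ ?_ ?_ ?_).2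
  · filter_upwards [hJ.mem_nhds ht] with r hr
    exact (hF.contDiff hr).continuous.aestronglyMeasurable
  · exact (hF.contDiff ht).continuous.intervalIntegrable _ _
  · exact (hF'.contDiff ht).continuous.aestronglyMeasurable
  · exact Filter.Eventually.of_forall fun u hu r hr => hC (r, u) ⟨hr, uIoc_subset_uIcc hu⟩
  · exact intervalIntegrable_const
  · exact Filter.Eventually.of_forall fun u _ r hr => hasDerivAt_time hJ hF (hball hr) u

end Open

theorem continuousOn_integral (hF : SmoothOnStrip J F) (a b : ℝ) :
    ContinuousOn (fun t => ∫ u in a..b, F t u) J := by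
  rw [continuousOn_iff_continuous_domRestrict]
  refine intervalIntegral.continuous_parametric_intervalIntegral_of_continuous'
    (f := fun (t : J) u => F t u) ?_ a b
  exact (ContDiffOn.continuousOn hF).comp_continuous
    (f := fun p : J × ℝ => ((p.1 : ℝ), p.2)) (by fun_prop) fun p => ⟨p.1.2, mem_univ _⟩

end SmoothOnStrip

end Families

/-! ### Geometry of a closed curve -/

/-- `c` is a smooth closed immersed curve, parametrised with period `2π`. -/
structure ClosedImmersed (c : ℝ → ℂ) : Prop where
  smooth : ContDiff ℝ ∞ c
  closed : Function.Periodic c (2 * Real.pi)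
  immersed : ∀ u, deriv c u ≠ 0

/-- In the plane, a unit vector `τ` and its rotation `iτ` form an orthonormal basis. -/
theorem eq_inner_smul_add_inner_smul {τ : ℂ} (hτ : ‖τ‖ = 1) (w : ℂ) :
    w = (inner ℝ w τ : ℝ) • τ + (inner ℝ w (Complex.I * τ) : ℝ) • (Complex.I * τ) := by
  have h : τ.re * τ.re + τ.im * τ.im = 1 := by
    rw [← Complex.normSq_apply, Complex.normSq_eq_norm_sq, hτ]; norm_num
  apply Complex.ext
  · simp [Complex.inner]
    linear_combination (-w.re) * h
  · simp [Complex.inner]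
    linear_combination (-w.im) * h

theorem inner_self_of_norm_eq_one {τ : ℂ} (hτ : ‖τ‖ = 1) : (inner ℝ τ τ : ℝ) = 1 := by
  rw [real_inner_self_eq_norm_sq, hτ]; norm_num

theorem inner_I_mul_self (w : ℂ) : (inner ℝ w (Complex.I * w) : ℝ) = 0 := by
  simp [Complex.inner, mul_comm]

theorem inner_I_mul_left_self (w : ℂ) : (inner ℝ (Complex.I * w) w : ℝ) = 0 := by
  rw [real_inner_comm, inner_I_mul_self]

theorem periodic_deriv {E : Type*} [NormedAddCommGroup E] [NormedSpace ℝ E] {f : ℝ → E} {p : ℝ}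
    (hf : Function.Periodic f p) : Function.Periodic (deriv f) p := fun u => by
  rw [← deriv_comp_add_const, hf.funext]

/-- The function `g` is the arclength derivative `f_s` of `f` along `c`, in the division-free form
`f_u = |c'| g`. -/
def HasArcDeriv (c : ℝ → ℂ) (f g : ℝ → ℝ) : Prop :=
  ∀ u, HasDerivAt f (speed c u * g u) u

namespace HasArcDeriv

variable {c : ℝ → ℂ} {f f' g g' : ℝ → ℝ}

theorem continuous (hf : HasArcDeriv c f f') : Continuous f :=
  continuous_iff_continuousAt.2 fun u => (hf u).continuousAt

theorem add (hf : HasArcDeriv c f f') (hg : HasArcDeriv c g g') :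
    HasArcDeriv c (fun u => f u + g u) (fun u => f' u + g' u) := fun u =>
  ((hf u).add (hg u)).congr_deriv (by ring)

theorem sub (hf : HasArcDeriv c f f') (hg : HasArcDeriv c g g') :
    HasArcDeriv c (fun u => f u - g u) (fun u => f' u - g' u) := fun u =>
  ((hf u).sub (hg u)).congr_deriv (by ring)

theorem mul (hf : HasArcDeriv c f f') (hg : HasArcDeriv c g g') :
    HasArcDeriv c (fun u => f u * g u) (fun u => f' u * g u + f u * g' u) := fun u =>
  ((hf u).mul (hg u)).congr_deriv (by ring)

theorem const_mul (a : ℝ) (hf : HasArcDeriv c f f') :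
    HasArcDeriv c (fun u => a * f u) (fun u => a * f' u) := fun u =>
  ((hf u).const_mul a).congr_deriv (by ring)

theorem sub_const (a : ℝ) (hf : HasArcDeriv c f f') :
    HasArcDeriv c (fun u => f u - a) f' := fun u => (hf u).sub_const a

theorem pow (hf : HasArcDeriv c f f') (n : ℕ) :
    HasArcDeriv c (fun u => f u ^ n) (fun u => n * f u ^ (n - 1) * f' u) := fun u =>
  ((hf u).pow n).congr_deriv (by ring)

theorem congr (hf : HasArcDeriv c f f') (h : ∀ u, f' u = g' u) : HasArcDeriv c f g' :=
  (funext h : f' = g') ▸ hf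

end HasArcDeriv

theorem arcIntegral_const_mul {c : ℝ → ℂ} (a : ℝ) (f : ℝ → ℝ) :
    arcIntegral c (fun u => a * f u) = a * arcIntegral c f := by
  simp only [arcIntegral, mul_assoc, intervalIntegral.integral_const_mul]

theorem arcIntegral_const {c : ℝ → ℂ} (a : ℝ) : arcIntegral c (fun _ => a) = a * length c := by
  rw [length, ← arcIntegral_const_mul, mul_one]

namespace ClosedImmersed

variable {c : ℝ → ℂ} (hc : ClosedImmersed c)
include hc

theorem speed_pos (u : ℝ) : 0 < speed c u := norm_pos_iff.2 (hc.immersed u)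

theorem contDiff_deriv : ContDiff ℝ ∞ (deriv c) := (contDiff_infty_iff_deriv.1 hc.smooth).2

theorem contDiff_speed : ContDiff ℝ ∞ (speed c) := hc.contDiff_deriv.norm ℝ hc.immersed

theorem continuous_speed : Continuous (speed c) := hc.contDiff_speed.continuous

theorem periodic_speed : Function.Periodic (speed c) (2 * Real.pi) := fun u => by
  simp only [speed, periodic_deriv hc.closed u]

section

variable {E : Type*} [NormedAddCommGroup E] [NormedSpace ℝ E] {f : ℝ → E}

theorem contDiff_arcDeriv (hf : ContDiff ℝ ∞ f) : ContDiff ℝ ∞ (arcDeriv c f) :=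
  (hc.contDiff_speed.inv fun u => (hc.speed_pos u).ne').smul
    ((contDiff_infty_iff_deriv (𝕜 := ℝ)).1 hf).2

theorem periodic_arcDeriv (hf : Function.Periodic f (2 * Real.pi)) :
    Function.Periodic (arcDeriv c f) (2 * Real.pi) := fun u => by
  simp only [arcDeriv, hc.periodic_speed u, periodic_deriv hf u]

theorem speed_smul_arcDeriv (f : ℝ → E) (u : ℝ) : speed c u • arcDeriv c f u = deriv f u := by
  rw [arcDeriv, smul_smul, mul_inv_cancel₀ (hc.speed_pos u).ne', one_smul]

theorem hasDerivAt_arcDeriv (hf : ContDiff ℝ ∞ f) (u : ℝ) :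
    HasDerivAt f (speed c u • arcDeriv c f u) u := by
  rw [hc.speed_smul_arcDeriv]
  exact (hf.differentiable (by simp) u).hasDerivAt

end

theorem hasArcDeriv {f : ℝ → ℝ} (hf : ContDiff ℝ ∞ f) : HasArcDeriv c f (arcDeriv c f) :=
  fun u => hc.hasDerivAt_arcDeriv hf u

theorem contDiff_tangent : ContDiff ℝ ∞ (tangent c) := hc.contDiff_arcDeriv hc.smooth

theorem periodic_tangent : Function.Periodic (tangent c) (2 * Real.pi) :=
  hc.periodic_arcDeriv hc.closed

theorem norm_tangent (u : ℝ) : ‖tangent c u‖ = 1 := by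
  have h : ‖deriv c u‖ ≠ 0 := (hc.speed_pos u).ne'
  rw [tangent, arcDeriv, norm_smul, speed, norm_inv, norm_norm, inv_mul_cancel₀ h]

theorem contDiff_normal : ContDiff ℝ ∞ (normal c) := contDiff_const.mul hc.contDiff_tangent

theorem periodic_normal : Function.Periodic (normal c) (2 * Real.pi) := fun u => by
  simp only [normal, hc.periodic_tangent u]

theorem contDiff_curvature : ContDiff ℝ ∞ (curvature c) :=
  (hc.contDiff_arcDeriv hc.contDiff_tangent).inner ℝ hc.contDiff_normal

theorem periodic_curvature : Function.Periodic (curvature c) (2 * Real.pi) := fun u => by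
  simp only [curvature, hc.periodic_arcDeriv hc.periodic_tangent u, hc.periodic_normal u]

theorem contDiff_curvatureS : ContDiff ℝ ∞ (curvatureS c) :=
  hc.contDiff_arcDeriv hc.contDiff_curvature

theorem periodic_curvatureS : Function.Periodic (curvatureS c) (2 * Real.pi) :=
  hc.periodic_arcDeriv hc.periodic_curvature

theorem contDiff_curvatureSS : ContDiff ℝ ∞ (curvatureSS c) :=
  hc.contDiff_arcDeriv hc.contDiff_curvatureS

theorem periodic_curvatureSS : Function.Periodic (curvatureSS c) (2 * Real.pi) :=
  hc.periodic_arcDeriv hc.periodic_curvatureS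

/-- The Frenet equation `τ_s = k ν`. -/
theorem arcDeriv_tangent (u : ℝ) : arcDeriv c (tangent c) u = curvature c u • normal c u := by
  have h1 := hc.hasDerivAt_arcDeriv hc.contDiff_tangent u
  have h2 : (inner ℝ (arcDeriv c (tangent c) u) (tangent c u) : ℝ) = 0 := by
    have h3 := h1.inner ℝ h1
    have h4 : (fun w => (inner ℝ (tangent c w) (tangent c w) : ℝ)) = fun _ => 1 :=
      funext fun w => inner_self_of_norm_eq_one (hc.norm_tangent w)
    rw [h4] at h3
    have h5 := h3.unique (hasDerivAt_const u 1)
    rw [real_inner_smul_right, real_inner_smul_left, real_inner_comm, ← two_mul] at h5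
    exact (mul_eq_zero.1 ((mul_eq_zero.1 h5).resolve_left two_ne_zero)).resolve_left
      (hc.speed_pos u).ne'
  have h6 := eq_inner_smul_add_inner_smul (hc.norm_tangent u) (arcDeriv c (tangent c) u)
  rw [h2, zero_smul, zero_add] at h6
  exact h6

theorem hasDerivAt_tangent (u : ℝ) :
    HasDerivAt (tangent c) ((speed c u * curvature c u) • normal c u) u := by
  have h := hc.hasDerivAt_arcDeriv hc.contDiff_tangent u
  rwa [hc.arcDeriv_tangent, smul_smul] at h

/-- The Frenet equation `ν_s = -k τ`. -/
theorem hasDerivAt_normal (u : ℝ) :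
    HasDerivAt (normal c) (-(speed c u * curvature c u) • tangent c u) u := by
  refine ((hc.hasDerivAt_tangent u).const_mul Complex.I).congr_deriv ?_
  rw [normal, mul_smul_comm, ← mul_assoc, Complex.I_mul_I, neg_one_mul, smul_neg, neg_smul]

theorem hasArcDeriv_inner_normal :
    HasArcDeriv c (fun u => inner ℝ (c u) (normal c u))
      (fun u => -(curvature c u * inner ℝ (c u) (tangent c u))) := fun u => by
  refine ((hc.hasDerivAt_arcDeriv hc.smooth u).inner ℝ (hc.hasDerivAt_normal u)).congr_deriv ?_
  change inner ℝ _ _ + inner ℝ (speed c u • tangent c u) (Complex.I * tangent c u) = _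
  rw [real_inner_smul_right, real_inner_smul_left, inner_I_mul_self]
  ring

theorem hasArcDeriv_inner_tangent :
    HasArcDeriv c (fun u => inner ℝ (c u) (tangent c u))
      (fun u => 1 + curvature c u * inner ℝ (c u) (normal c u)) := fun u => by
  refine ((hc.hasDerivAt_arcDeriv hc.smooth u).inner ℝ (hc.hasDerivAt_tangent u)).congr_deriv ?_
  change inner ℝ _ _ + inner ℝ (speed c u • tangent c u) (tangent c u) = _
  rw [real_inner_smul_right, real_inner_smul_left, inner_self_of_norm_eq_one (hc.norm_tangent u)]
  ring

/-! ### Integration along a closed curve -/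

theorem arcIntegral_add {f g : ℝ → ℝ} (hf : Continuous f) (hg : Continuous g) :
    arcIntegral c (fun u => f u + g u) = arcIntegral c f + arcIntegral c g := by
  have hv := hc.continuous_speed
  simp only [arcIntegral, add_mul]
  exact intervalIntegral.integral_add
    ((hf.mul hv).intervalIntegrable _ _) ((hg.mul hv).intervalIntegrable _ _)

theorem arcIntegral_mono {f g : ℝ → ℝ} (hf : Continuous f) (hg : Continuous g)
    (h : ∀ u, f u ≤ g u) : arcIntegral c f ≤ arcIntegral c g := by
  have hv := hc.continuous_speed
  refine intervalIntegral.integral_mono_on (by positivity)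
    ((hf.mul hv).intervalIntegrable _ _) ((hg.mul hv).intervalIntegrable _ _) fun u _ => ?_
  exact mul_le_mul_of_nonneg_right (h u) (hc.speed_pos u).le

theorem arcIntegral_nonneg {f : ℝ → ℝ} (h : ∀ u, 0 ≤ f u) : 0 ≤ arcIntegral c f :=
  intervalIntegral.integral_nonneg (by positivity) fun u _ => mul_nonneg (h u) (hc.speed_pos u).le

/-- The arclength derivative of a periodic function has integral zero. -/
theorem arcIntegral_of_hasArcDeriv {f g : ℝ → ℝ} (hfg : HasArcDeriv c f g) (hg : Continuous g)
    (hf : Function.Periodic f (2 * Real.pi)) : arcIntegral c g = 0 := by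
  have hv := hc.continuous_speed
  have h : arcIntegral c g = f (2 * Real.pi) - f 0 := by
    rw [arcIntegral, ← intervalIntegral.integral_eq_sub_of_hasDerivAt (fun u _ => hfg u)
      ((hv.mul hg).intervalIntegrable _ _)]
    simp only [mul_comm]
  rw [h, ← hf 0, zero_add, sub_self]

/-- Integration by parts: integrands that differ by the arclength derivative of a periodic function
have the same integral. -/
theorem arcIntegral_congr_of_hasArcDeriv {F f g : ℝ → ℝ} (hf : Continuous f) (hg : Continuous g)
    (hF : Function.Periodic F (2 * Real.pi)) (h : HasArcDeriv c F (fun u => f u - g u)) :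
    arcIntegral c f = arcIntegral c g := by
  have h1 := hc.arcIntegral_of_hasArcDeriv h (hf.sub hg) hF
  have h2 := hc.arcIntegral_add (f := fun u => f u - g u) (hf.sub hg) hg
  rw [h1, zero_add] at h2
  rw [← h2]
  simp only [sub_add_cancel]

theorem arcIntegral_mul_sq_le {f g : ℝ → ℝ} (hf : Continuous f) (hg : Continuous g) :
    arcIntegral c (fun u => f u * g u) ^ 2 ≤
      arcIntegral c (fun u => f u ^ 2) * arcIntegral c (fun u => g u ^ 2) := by
  have h : ∀ x : ℝ, 0 ≤ arcIntegral c (fun u => g u ^ 2) * (x * x) +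
      (2 * arcIntegral c (fun u => f u * g u)) * x + arcIntegral c (fun u => f u ^ 2) := fun x => by
    have h1 := hc.arcIntegral_nonneg (f := fun u => (x * x) * g u ^ 2 + ((2 * x) * (f u * g u) +
      f u ^ 2)) fun u => by nlinarith [sq_nonneg (x * g u + f u)]
    rw [hc.arcIntegral_add (by fun_prop) (by fun_prop), hc.arcIntegral_add (by fun_prop)
      (by fun_prop), arcIntegral_const_mul, arcIntegral_const_mul] at h1
    linarith
  have := discrim_le_zero h
  rw [discrim] at this
  linarith

theorem length_pos : 0 < length c := by
  rw [length, arcIntegral]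
  refine intervalIntegral.intervalIntegral_pos_of_pos
    ((continuous_const.mul hc.continuous_speed).intervalIntegrable _ _)
    (fun u => by simpa using hc.speed_pos u) (by positivity)

/-- Two values of a function differ by at most the integral of the absolute value of its arclength
derivative. -/
theorem abs_sub_le_arcIntegral {f g : ℝ → ℝ} (hfg : HasArcDeriv c f g) (hg : Continuous g)
    (hf : Function.Periodic f (2 * Real.pi)) (x y : ℝ) :
    |f x - f y| ≤ arcIntegral c (fun u => |g u|) := by
  have hv := hc.continuous_speed
  have key : ∀ a ∈ Ico 0 (2 * Real.pi), ∀ b ∈ Ico 0 (2 * Real.pi), a ≤ b →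
      |f b - f a| ≤ arcIntegral c (fun u => |g u|) := fun a ha b hb hab => by
    rw [← intervalIntegral.integral_eq_sub_of_hasDerivAt (fun u _ => hfg u)
      ((hv.mul hg).intervalIntegrable _ _)]
    refine (intervalIntegral.abs_integral_le_integral_abs hab).trans ?_
    have h1 : (fun u => |speed c u * g u|) = fun u => |g u| * speed c u := funext fun u => by
      rw [abs_mul, abs_of_pos (hc.speed_pos u), mul_comm]
    rw [h1, arcIntegral]
    refine intervalIntegral.integral_mono_interval ha.1 hab hb.2.le
      (Filter.Eventually.of_forall fun u => mul_nonneg (abs_nonneg _) (hc.speed_pos u).le)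
      ((hg.abs.mul hv).intervalIntegrable _ _)
  obtain ⟨a, ha, hxa⟩ := hf.exists_mem_Ico₀ Real.two_pi_pos x
  obtain ⟨b, hb, hyb⟩ := hf.exists_mem_Ico₀ Real.two_pi_pos y
  rw [hxa, hyb]
  rcases le_total a b with h | h
  · rw [abs_sub_comm]; exact key a ha b hb h
  · exact key b hb a ha h

/-- A function of mean zero along the curve vanishes somewhere. -/
theorem exists_eq_zero_of_arcIntegral_eq_zero {f : ℝ → ℝ} (hf : Continuous f)
    (h : arcIntegral c f = 0) : ∃ x, f x = 0 := by
  have hv := hc.continuous_speed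
  by_contra! hne
  have hint : IntervalIntegrable (fun u => f u * speed c u) MeasureTheory.volume 0 (2 * Real.pi) :=
    (hf.mul hv).intervalIntegrable _ _
  have hsign : (∀ u, 0 < f u) ∨ ∀ u, f u < 0 := by
    by_contra! hcon
    obtain ⟨⟨x, hx⟩, y, hy⟩ := hcon
    obtain ⟨z, hz⟩ := mem_range_of_exists_le_of_exists_ge hf ⟨x, hx⟩ ⟨y, hy⟩
    exact hne z hz
  rcases hsign with hs | hs
  · exact (intervalIntegral.intervalIntegral_pos_of_pos hint
      (fun u => mul_pos (hs u) (hc.speed_pos u)) Real.two_pi_pos).ne' h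
  · have := intervalIntegral.intervalIntegral_pos_of_pos hint.neg
      (fun u => neg_pos.2 (mul_neg_of_neg_of_pos (hs u) (hc.speed_pos u))) Real.two_pi_pos
    rw [arcIntegral] at h
    simp [h] at this

end ClosedImmersed

/-! ### Curves moving in the normal direction -/

section Strip

variable {E : Type*} [NormedAddCommGroup E] [NormedSpace ℝ E]
variable {J : Set ℝ} {γ : ℝ → ℝ → ℂ}

theorem smoothOnStrip_speed (hJ : UniqueDiffOn ℝ J) (hγ : SmoothOnStrip J γ)
    (hc : ∀ t ∈ J, ClosedImmersed (γ t)) : SmoothOnStrip J fun t => speed (γ t) :=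
  ContDiffOn.norm ℝ (hγ.deriv_param hJ) fun p hp => (hc p.1 hp.1).immersed p.2

theorem smoothOnStrip_arcDeriv (hJ : UniqueDiffOn ℝ J) (hγ : SmoothOnStrip J γ)
    (hc : ∀ t ∈ J, ClosedImmersed (γ t)) {F : ℝ → ℝ → E} (hF : SmoothOnStrip J F) :
    SmoothOnStrip J fun t => arcDeriv (γ t) (F t) :=
  ContDiffOn.smul (ContDiffOn.inv (smoothOnStrip_speed hJ hγ hc)
    fun p hp => ((hc p.1 hp.1).speed_pos p.2).ne') (hF.deriv_param hJ)

theorem smoothOnStrip_tangent (hJ : UniqueDiffOn ℝ J) (hγ : SmoothOnStrip J γ)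
    (hc : ∀ t ∈ J, ClosedImmersed (γ t)) : SmoothOnStrip J fun t => tangent (γ t) :=
  smoothOnStrip_arcDeriv hJ hγ hc hγ

theorem smoothOnStrip_normal (hJ : UniqueDiffOn ℝ J) (hγ : SmoothOnStrip J γ)
    (hc : ∀ t ∈ J, ClosedImmersed (γ t)) : SmoothOnStrip J fun t => normal (γ t) :=
  ContDiffOn.mul contDiffOn_const (smoothOnStrip_tangent hJ hγ hc)

theorem smoothOnStrip_curvature (hJ : UniqueDiffOn ℝ J) (hγ : SmoothOnStrip J γ)
    (hc : ∀ t ∈ J, ClosedImmersed (γ t)) : SmoothOnStrip J fun t => curvature (γ t) :=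
  ContDiffOn.inner ℝ (smoothOnStrip_arcDeriv hJ hγ hc (smoothOnStrip_tangent hJ hγ hc))
    (smoothOnStrip_normal hJ hγ hc)

theorem smoothOnStrip_curvatureS (hJ : UniqueDiffOn ℝ J) (hγ : SmoothOnStrip J γ)
    (hc : ∀ t ∈ J, ClosedImmersed (γ t)) : SmoothOnStrip J fun t => curvatureS (γ t) :=
  smoothOnStrip_arcDeriv hJ hγ hc (smoothOnStrip_curvature hJ hγ hc)

theorem continuousOn_arcIntegral (hJ : UniqueDiffOn ℝ J) (hγ : SmoothOnStrip J γ)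
    (hc : ∀ t ∈ J, ClosedImmersed (γ t)) {F : ℝ → ℝ → ℝ} (hF : SmoothOnStrip J F) :
    ContinuousOn (fun t => arcIntegral (γ t) (F t)) J :=
  SmoothOnStrip.continuousOn_integral (F := fun t u => F t u * speed (γ t) u)
    (ContDiffOn.mul hF (smoothOnStrip_speed hJ hγ hc)) _ _

end Strip

/-- A smooth family of closed immersed curves `γ t`, over an open set `J` of times, that moves in
the normal direction with normal speed `V`. -/
structure IsNormalVariation (J : Set ℝ) (γ : ℝ → ℝ → ℂ) (V : ℝ → ℝ → ℝ) : Prop where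
  isOpen : IsOpen J
  smooth : SmoothOnStrip J γ
  closedImmersed : ∀ t ∈ J, ClosedImmersed (γ t)
  evolution : ∀ t ∈ J, ∀ u, HasDerivAt (fun r => γ r u) (V t u • normal (γ t) u) t

namespace IsNormalVariation

variable {E : Type*} [NormedAddCommGroup E] [NormedSpace ℝ E]
variable {J : Set ℝ} {γ : ℝ → ℝ → ℂ} {V : ℝ → ℝ → ℝ} (h : IsNormalVariation J γ V)
include h

/-- The normal speed is recovered from the velocity, so it inherits its smoothness. -/
theorem smooth_normalSpeed : SmoothOnStrip J V := by
  refine SmoothOnStrip.congr (F := fun t u => inner ℝ (deriv (fun r => γ r u) t) (normal (γ t) u))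
    (ContDiffOn.inner ℝ (h.smooth.deriv_time h.isOpen)
      (smoothOnStrip_normal h.isOpen.uniqueDiffOn h.smooth h.closedImmersed)) fun t ht u => ?_
  have hn : ‖normal (γ t) u‖ = 1 := by
    rw [normal, norm_mul, Complex.norm_I, one_mul, (h.closedImmersed t ht).norm_tangent]
  rw [(h.evolution t ht u).deriv, real_inner_smul_left, inner_self_of_norm_eq_one hn, mul_one]

variable {t : ℝ} (ht : t ∈ J)
include ht

theorem hasDerivAt_normalSpeed_smul_normal (u : ℝ) :
    HasDerivAt (fun w => V t w • normal (γ t) w)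
      (speed (γ t) u • (arcDeriv (γ t) (V t) u • normal (γ t) u
        - (curvature (γ t) u * V t u) • tangent (γ t) u)) u := by
  have hc := h.closedImmersed t ht
  refine ((hc.hasArcDeriv (h.smooth_normalSpeed.contDiff ht) u).smul
    (hc.hasDerivAt_normal u)).congr_deriv ?_
  module

/-- The length element evolves by `∂_t |γ_u| = -k V |γ_u|`. -/
theorem hasDerivAt_speed (u : ℝ) :
    HasDerivAt (fun r => speed (γ r) u) (-(curvature (γ t) u * V t u) * speed (γ t) u) t := by
  have hc := h.closedImmersed t ht
  have hv := hc.speed_pos u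
  have h1 := h.smooth.hasDerivAt_deriv_param h.isOpen ht u (h.evolution t ht)
  rw [(h.hasDerivAt_normalSpeed_smul_normal ht u).deriv] at h1
  have h2 := h1.norm_sq.sqrt (pow_ne_zero 2 hv.ne')
  simp only [Real.sqrt_sq (norm_nonneg _)] at h2
  refine h2.congr_deriv ?_
  have h3 : deriv (γ t) u = speed (γ t) u • tangent (γ t) u :=
    (hc.speed_smul_arcDeriv (γ t) u).symm
  have h4 : ‖deriv (γ t) u‖ = speed (γ t) u := rfl
  rw [h4, h3, real_inner_smul_left, real_inner_smul_right, inner_sub_right, real_inner_smul_right,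
    real_inner_smul_right, inner_self_of_norm_eq_one (hc.norm_tangent u), normal,
    inner_I_mul_self]
  field_simp
  ring

/-- The commutator `∂_t ∂_s = ∂_s ∂_t + k V ∂_s` of the time and arclength derivatives. -/
theorem hasDerivAt_arcDeriv {F : ℝ → ℝ → E} (hF : SmoothOnStrip J F) {G : ℝ → E}
    (hG : ∀ w, HasDerivAt (fun r => F r w) (G w) t) (u : ℝ) :
    HasDerivAt (fun r => arcDeriv (γ r) (F r) u)
      (arcDeriv (γ t) G u + (curvature (γ t) u * V t u) • arcDeriv (γ t) (F t) u) t := by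
  have hv := ((h.closedImmersed t ht).speed_pos u).ne'
  refine (((h.hasDerivAt_speed ht u).inv hv).smul
    (hF.hasDerivAt_deriv_param h.isOpen ht u hG)).congr_deriv ?_
  simp only [arcDeriv, smul_smul]
  congr 2
  field_simp

theorem hasDerivAt_tangent (u : ℝ) :
    HasDerivAt (fun r => tangent (γ r) u) (arcDeriv (γ t) (V t) u • normal (γ t) u) t := by
  have hv := ((h.closedImmersed t ht).speed_pos u).ne'
  refine (h.hasDerivAt_arcDeriv ht h.smooth
    (h.evolution t ht) u).congr_deriv ?_
  rw [arcDeriv, (h.hasDerivAt_normalSpeed_smul_normal ht u).deriv, smul_smul, inv_mul_cancel₀ hv,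
    one_smul]
  exact sub_add_cancel _ _

theorem hasDerivAt_normal (u : ℝ) :
    HasDerivAt (fun r => normal (γ r) u) (-arcDeriv (γ t) (V t) u • tangent (γ t) u) t := by
  refine ((h.hasDerivAt_tangent ht u).const_mul Complex.I).congr_deriv ?_
  rw [normal, mul_smul_comm, ← mul_assoc, Complex.I_mul_I, neg_one_mul, smul_neg, neg_smul]

/-- The curvature evolves by `k_t = V_ss + k² V`. -/
theorem hasDerivAt_curvature (u : ℝ) :
    HasDerivAt (fun r => curvature (γ r) u)
      (arcDeriv (γ t) (arcDeriv (γ t) (V t)) u + curvature (γ t) u ^ 2 * V t u) t := by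
  have hc := h.closedImmersed t ht
  have hv := (hc.speed_pos u).ne'
  have hV : ContDiff ℝ ∞ (V t) := h.smooth_normalSpeed.contDiff ht
  have hd : HasDerivAt (fun w => arcDeriv (γ t) (V t) w • normal (γ t) w) _ u :=
    (hc.hasArcDeriv (hc.contDiff_arcDeriv hV) u).smul (hc.hasDerivAt_normal u)
  have hn : ‖normal (γ t) u‖ = 1 := by
    rw [normal, norm_mul, Complex.norm_I, one_mul, hc.norm_tangent]
  have h1 := h.hasDerivAt_arcDeriv ht
    (smoothOnStrip_tangent h.isOpen.uniqueDiffOn h.smooth h.closedImmersed)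
    (h.hasDerivAt_tangent ht) u
  refine (h1.inner ℝ (h.hasDerivAt_normal ht u)).congr_deriv ?_
  have h2 : arcDeriv (γ t) (fun u => arcDeriv (γ t) (V t) u • normal (γ t) u) u =
      arcDeriv (γ t) (arcDeriv (γ t) (V t)) u • normal (γ t) u
        - (arcDeriv (γ t) (V t) u * curvature (γ t) u) • tangent (γ t) u := by
    rw [arcDeriv, hd.deriv, smul_add, smul_smul, smul_smul, smul_smul, ← mul_assoc,
      inv_mul_cancel₀ hv, one_mul, sub_eq_add_neg, ← neg_smul, add_comm]
    congr 2
    field_simp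
  have h3 : (inner ℝ (normal (γ t) u) (tangent (γ t) u) : ℝ) = 0 := inner_I_mul_left_self _
  have h4 : (inner ℝ (tangent (γ t) u) (normal (γ t) u) : ℝ) = 0 := inner_I_mul_self _
  rw [h2, hc.arcDeriv_tangent]
  simp only [inner_add_left, inner_sub_left, real_inner_smul_left, real_inner_smul_right, h3, h4,
    inner_self_of_norm_eq_one hn]
  ring

theorem hasDerivAt_curvatureS (u : ℝ) :
    HasDerivAt (fun r => curvatureS (γ r) u)
      (arcDeriv (γ t) (fun w => arcDeriv (γ t) (arcDeriv (γ t) (V t)) w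
        + curvature (γ t) w ^ 2 * V t w) u
        + curvature (γ t) u * V t u * curvatureS (γ t) u) t :=
  h.hasDerivAt_arcDeriv ht
    (smoothOnStrip_curvature h.isOpen.uniqueDiffOn h.smooth h.closedImmersed)
    (h.hasDerivAt_curvature ht) u

theorem hasDerivAt_arcIntegral {F : ℝ → ℝ → ℝ} (hF : SmoothOnStrip J F) {G : ℝ → ℝ}
    (hG : ∀ w, HasDerivAt (fun r => F r w) (G w) t) :
    HasDerivAt (fun r => arcIntegral (γ r) (F r))
      (arcIntegral (γ t) fun u => G u - curvature (γ t) u * V t u * F t u) t := by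
  refine (SmoothOnStrip.hasDerivAt_integral (F := fun t u => F t u * speed (γ t) u) h.isOpen
    (ContDiffOn.mul hF (smoothOnStrip_speed h.isOpen.uniqueDiffOn h.smooth h.closedImmersed)) ht
    fun w => (hG w).mul (h.hasDerivAt_speed ht w)).congr_deriv ?_
  rw [arcIntegral]
  congr 1
  ext u
  ring

end IsNormalVariation

/-! ### Integral identities for the rescaled free elastic flow -/

/-- The velocity of the rescaled flow in the normal direction, with an arbitrary dilation
factor `l` in place of the rescaling factor `λ`. -/
def normalSpeed (l : ℝ) (c : ℝ → ℂ) (u : ℝ) : ℝ :=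
  -(2 * curvatureSS c u + curvature c u ^ 3 - l * inner ℝ (c u) (normal c u))

namespace ClosedImmersed

variable {c : ℝ → ℂ} (hc : ClosedImmersed c)
include hc

theorem hasArcDeriv_curvature : HasArcDeriv c (curvature c) (curvatureS c) :=
  hc.hasArcDeriv hc.contDiff_curvature

theorem hasArcDeriv_curvatureS : HasArcDeriv c (curvatureS c) (curvatureSS c) :=
  hc.hasArcDeriv hc.contDiff_curvatureS

theorem hasArcDeriv_curvatureSS : HasArcDeriv c (curvatureSS c) (arcDeriv c (curvatureSS c)) :=
  hc.hasArcDeriv hc.contDiff_curvatureSS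

theorem contDiff_inner_normal : ContDiff ℝ ∞ fun u => (inner ℝ (c u) (normal c u) : ℝ) :=
  hc.smooth.inner ℝ hc.contDiff_normal

theorem contDiff_normalSpeed (l : ℝ) : ContDiff ℝ ∞ (normalSpeed l c) := by
  have h1 := hc.contDiff_curvature
  have h2 := hc.contDiff_curvatureSS
  have h3 := hc.contDiff_inner_normal
  unfold normalSpeed
  fun_prop

theorem periodic_normalSpeed (l : ℝ) : Function.Periodic (normalSpeed l c) (2 * Real.pi) :=
  fun u => by
    simp only [normalSpeed, hc.periodic_curvature u, hc.periodic_curvatureSS u, hc.closed u,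
      hc.periodic_normal u]

theorem arcDeriv_normalSpeed (l : ℝ) (u : ℝ) :
    arcDeriv c (normalSpeed l c) u = -(2 * arcDeriv c (curvatureSS c) u
      + 3 * curvature c u ^ 2 * curvatureS c u
      + l * (curvature c u * inner ℝ (c u) (tangent c u))) := by
  have h1 := (hc.hasArcDeriv (hc.contDiff_normalSpeed l)) u
  have h2 := ((((hc.hasArcDeriv_curvatureSS.const_mul 2).add (hc.hasArcDeriv_curvature.pow 3)).sub
    (hc.hasArcDeriv_inner_normal.const_mul l)).const_mul (-1)) u
  have h3 : normalSpeed l c = fun u => -1 * (2 * curvatureSS c u + curvature c u ^ 3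
      - l * inner ℝ (c u) (normal c u)) := funext fun u => by rw [normalSpeed]; ring
  rw [h3] at h1 ⊢
  have h4 := mul_left_cancel₀ (hc.speed_pos u).ne' (h1.unique h2)
  rw [h4]
  push_cast
  ring

theorem arcIntegral_curvature_mul_normalSpeed (l : ℝ) :
    arcIntegral c (fun u => 0 - curvature c u * normalSpeed l c u * 1) =
      l * length c - (2 * ksNormSq c - arcIntegral c fun u => curvature c u ^ 4) := by
  have ck := hc.contDiff_curvature.continuous
  have ck1 := hc.contDiff_curvatureS.continuous
  have cV := (hc.contDiff_normalSpeed l).continuous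
  have h1 : arcIntegral c (fun u => 0 - curvature c u * normalSpeed l c u * 1) =
      arcIntegral c fun u => -2 * curvatureS c u ^ 2 + (curvature c u ^ 4 + l) := by
    refine hc.arcIntegral_congr_of_hasArcDeriv (by fun_prop) (by fun_prop)
      (F := fun u => 2 * (curvature c u * curvatureS c u) - l * inner ℝ (c u) (tangent c u))
      (fun u => ?_) ?_
    · simp only [hc.periodic_curvature u, hc.periodic_curvatureS u, hc.closed u,
        hc.periodic_tangent u]
    · refine (((hc.hasArcDeriv_curvature.mul hc.hasArcDeriv_curvatureS).const_mul 2).sub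
        (hc.hasArcDeriv_inner_tangent.const_mul l)).congr fun u => ?_
      simp only [normalSpeed]
      ring
  rw [h1, hc.arcIntegral_add (by fun_prop) (by fun_prop), hc.arcIntegral_add (by fun_prop)
    (by fun_prop), arcIntegral_const_mul, arcIntegral_const, ksNormSq]
  ring

/-- Under a normal variation the total curvature is stationary. -/
theorem arcIntegral_variation_curvature {V : ℝ → ℝ} (hV : ContDiff ℝ ∞ V)
    (pV : Function.Periodic V (2 * Real.pi)) :
    arcIntegral c (fun u => arcDeriv c (arcDeriv c V) u + curvature c u ^ 2 * V u
      - curvature c u * V u * curvature c u) = 0 := by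
  have hV1 := hc.contDiff_arcDeriv hV
  refine hc.arcIntegral_of_hasArcDeriv (f := arcDeriv c V)
    ((hc.hasArcDeriv hV1).congr fun u => by ring) ?_ (hc.periodic_arcDeriv pV)
  have h1 := (hc.contDiff_arcDeriv hV1).continuous
  have h2 := hV.continuous
  have h3 := hc.contDiff_curvature.continuous
  fun_prop

/-- The first variation of the elastic energy `∫ k² ds`. -/
theorem arcIntegral_variation_curvature_sq (l : ℝ) :
    arcIntegral c (fun u => 2 * curvature c u *
      (arcDeriv c (arcDeriv c (normalSpeed l c)) u + curvature c u ^ 2 * normalSpeed l c u)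
      - curvature c u * normalSpeed l c u * curvature c u ^ 2) =
    arcIntegral c (fun u => -4 * curvatureSS c u ^ 2 + 12 * curvature c u ^ 2 * curvatureS c u ^ 2
      - curvature c u ^ 6 - l * curvature c u ^ 2) := by
  have ck := hc.contDiff_curvature.continuous
  have ck1 := hc.contDiff_curvatureS.continuous
  have ck2 := hc.contDiff_curvatureSS.continuous
  have sV := hc.contDiff_normalSpeed l
  have sV1 := hc.contDiff_arcDeriv sV
  have cV := sV.continuous
  have cV2 := (hc.contDiff_arcDeriv sV1).continuous
  have dk := hc.hasArcDeriv_curvature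
  have dk1 := hc.hasArcDeriv_curvatureS
  have dp := hc.hasArcDeriv_inner_normal
  have dq := hc.hasArcDeriv_inner_tangent
  refine hc.arcIntegral_congr_of_hasArcDeriv (by fun_prop) (by fun_prop)
    (F := fun u => 2 * (curvature c u * arcDeriv c (normalSpeed l c) u)
      - 2 * (curvatureS c u * normalSpeed l c u) - 4 * (curvature c u ^ 3 * curvatureS c u)
      + l * (2 * (inner ℝ (c u) (normal c u) * curvatureS c u)
        + curvature c u ^ 2 * inner ℝ (c u) (tangent c u))) (fun u => ?_) ?_
  · simp only [hc.periodic_curvature u, hc.periodic_curvatureS u, hc.closed u,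
      hc.periodic_tangent u, hc.periodic_normal u, hc.periodic_normalSpeed l u,
      hc.periodic_arcDeriv (hc.periodic_normalSpeed l) u]
  · refine (((((dk.mul (hc.hasArcDeriv sV1)).const_mul 2).sub
      ((dk1.mul (hc.hasArcDeriv sV)).const_mul 2)).sub (((dk.pow 3).mul dk1).const_mul 4)).add
      ((((dp.mul dk1).const_mul 2).add ((dk.pow 2).mul dq)).const_mul l)).congr fun u => ?_
    simp only [normalSpeed]
    push_cast
    ring

/-- The first variation of `∫ k_s² ds`. The dilation by `l` contributes `-3 l ∫ k_s² ds`, as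
`∫ k_s² ds` scales like the inverse cube of the length. -/
theorem arcIntegral_variation_curvatureS_sq (l : ℝ) :
    arcIntegral c (fun u => 2 * curvatureS c u *
      (arcDeriv c (fun w => arcDeriv c (arcDeriv c (normalSpeed l c)) w
        + curvature c w ^ 2 * normalSpeed l c w) u
        + curvature c u * normalSpeed l c u * curvatureS c u)
      - curvature c u * normalSpeed l c u * curvatureS c u ^ 2) =
    arcIntegral c (fun u => -4 * arcDeriv c (curvatureSS c) u ^ 2
      + 10 * curvature c u ^ 2 * curvatureSS c u ^ 2 - 10 / 3 * curvatureS c u ^ 4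
      - 11 * curvature c u ^ 4 * curvatureS c u ^ 2 - 3 * l * curvatureS c u ^ 2) := by
  have sk := hc.contDiff_curvature
  have ck := sk.continuous
  have ck1 := hc.contDiff_curvatureS.continuous
  have ck2 := hc.contDiff_curvatureSS.continuous
  have ck3 := (hc.contDiff_arcDeriv hc.contDiff_curvatureSS).continuous
  have sV := hc.contDiff_normalSpeed l
  have sV1 := hc.contDiff_arcDeriv sV
  have sV2 := hc.contDiff_arcDeriv sV1
  have cV := sV.continuous
  have cV2 := sV2.continuous
  have sW : ContDiff ℝ ∞ fun w => arcDeriv c (arcDeriv c (normalSpeed l c)) w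
      + curvature c w ^ 2 * normalSpeed l c w := by fun_prop
  have cW1 := (hc.contDiff_arcDeriv sW).continuous
  have dk := hc.hasArcDeriv_curvature
  have dk1 := hc.hasArcDeriv_curvatureS
  have dk2 := hc.hasArcDeriv_curvatureSS
  have dq := hc.hasArcDeriv_inner_tangent
  have pV := hc.periodic_normalSpeed l
  have pV1 := hc.periodic_arcDeriv pV
  refine hc.arcIntegral_congr_of_hasArcDeriv (by fun_prop) (by fun_prop)
    (F := fun u => 2 * (curvatureS c u * (arcDeriv c (arcDeriv c (normalSpeed l c)) u
        + curvature c u ^ 2 * normalSpeed l c u))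
      - 2 * (curvatureSS c u * arcDeriv c (normalSpeed l c) u)
      + l * (curvatureS c u ^ 2 * inner ℝ (c u) (tangent c u)
        + 2 * (curvature c u * curvatureS c u)
        - 2 * (curvature c u * curvatureSS c u * inner ℝ (c u) (tangent c u)))
      + (2 * (curvature c u ^ 5 * curvatureS c u) + 10 / 3 * (curvature c u * curvatureS c u ^ 3)
        - 6 * (curvature c u ^ 2 * curvatureS c u * curvatureSS c u))) (fun u => ?_) ?_
  · simp only [hc.periodic_curvature u, hc.periodic_curvatureS u, hc.periodic_curvatureSS u,
      hc.closed u, hc.periodic_tangent u, pV u, pV1 u, hc.periodic_arcDeriv pV1 u]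
  · refine (((((dk1.mul (hc.hasArcDeriv sW)).const_mul 2).sub
      ((dk2.mul (hc.hasArcDeriv sV1)).const_mul 2)).add
      (((((dk1.pow 2).mul dq).add ((dk.mul dk1).const_mul 2)).sub
        (((dk.mul dk2).mul dq).const_mul 2)).const_mul l)).add
      (((((dk.pow 5).mul dk1).const_mul 2).add ((dk.mul (dk1.pow 3)).const_mul (10 / 3))).sub
        ((((dk.pow 2).mul dk1).mul dk2).const_mul 6))).congr fun u => ?_
    simp only [hc.arcDeriv_normalSpeed l u]
    simp only [normalSpeed]
    push_cast
    ring

end ClosedImmersed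

/-! ### Interpolation along a closed curve -/

namespace ClosedImmersed

variable {c : ℝ → ℂ} (hc : ClosedImmersed c) {f g h : ℝ → ℝ}
include hc

theorem sq_arcIntegral_abs_le (hg : Continuous g) :
    arcIntegral c (fun u => |g u|) ^ 2 ≤ length c * arcIntegral c (fun u => g u ^ 2) := by
  have h1 := hc.arcIntegral_mul_sq_le (f := fun _ => 1) (g := fun u => |g u|) continuous_const
    hg.abs
  rw [length]
  simpa only [one_mul, one_pow, sq_abs] using h1

theorem sq_le_length_mul (hfg : HasArcDeriv c f g) (hg : Continuous g)
    (pf : Function.Periodic f (2 * Real.pi)) (h0 : arcIntegral c f = 0) (u : ℝ) :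
    f u ^ 2 ≤ length c * arcIntegral c (fun u => g u ^ 2) := by
  obtain ⟨x, hx⟩ := hc.exists_eq_zero_of_arcIntegral_eq_zero hfg.continuous h0
  have h1 := hc.abs_sub_le_arcIntegral hfg hg pf u x
  rw [hx, sub_zero] at h1
  rw [← sq_abs]
  exact (pow_le_pow_left₀ (abs_nonneg _) h1 2).trans (hc.sq_arcIntegral_abs_le hg)

theorem pow_four_le_mul (hfg : HasArcDeriv c f g) (hg : Continuous g)
    (pf : Function.Periodic f (2 * Real.pi)) (h0 : arcIntegral c f = 0) (u : ℝ) :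
    f u ^ 4 ≤ 4 * (arcIntegral c (fun u => f u ^ 2) * arcIntegral c (fun u => g u ^ 2)) := by
  have hf := hfg.continuous
  obtain ⟨x, hx⟩ := hc.exists_eq_zero_of_arcIntegral_eq_zero hf h0
  have h1 := hc.abs_sub_le_arcIntegral (f := fun u => f u ^ 2) (g := fun u => 2 * (f u * g u))
    ((hfg.pow 2).congr fun u => by push_cast; ring) (by fun_prop)
    (fun u => by simp only [pf u]) u x
  have h2 : arcIntegral c (fun u => |2 * (f u * g u)|) =
      2 * arcIntegral c (fun u => |f u| * |g u|) := by
    rw [← arcIntegral_const_mul]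
    simp only [abs_mul, abs_two]
  have h3 := hc.arcIntegral_mul_sq_le hf.abs hg.abs
  simp only [sq_abs] at h3
  have h4 : (0 : ℝ) ^ 2 = 0 := by norm_num
  rw [hx, h4, sub_zero, h2] at h1
  have h5 := pow_le_pow_left₀ (abs_nonneg _) h1 2
  rw [sq_abs] at h5
  nlinarith

/-- A Poincaré inequality, with a constant that is not sharp. -/
theorem arcIntegral_sq_le (hfg : HasArcDeriv c f g) (hg : Continuous g)
    (pf : Function.Periodic f (2 * Real.pi)) (h0 : arcIntegral c f = 0) :
    arcIntegral c (fun u => f u ^ 2) ≤ length c ^ 2 * arcIntegral c (fun u => g u ^ 2) := by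
  have hf := hfg.continuous
  have h1 := hc.arcIntegral_mono (f := fun u => f u ^ 2) (by fun_prop) continuous_const
    (hc.sq_le_length_mul hfg hg pf h0)
  rw [arcIntegral_const] at h1
  linarith

theorem sq_arcIntegral_sq_le (hfg : HasArcDeriv c f g) (hgh : HasArcDeriv c g h)
    (hh : Continuous h) (pf : Function.Periodic f (2 * Real.pi))
    (pg : Function.Periodic g (2 * Real.pi)) :
    arcIntegral c (fun u => g u ^ 2) ^ 2 ≤
      arcIntegral c (fun u => f u ^ 2) * arcIntegral c (fun u => h u ^ 2) := by
  have hf := hfg.continuous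
  have hg := hgh.continuous
  have h1 : arcIntegral c (fun u => g u ^ 2) = arcIntegral c fun u => -1 * (f u * h u) :=
    hc.arcIntegral_congr_of_hasArcDeriv (F := fun u => f u * g u) (by fun_prop) (by fun_prop)
      (fun u => by simp only [pf u, pg u]) ((hfg.mul hgh).congr fun u => by ring)
  rw [h1, arcIntegral_const_mul, mul_pow]
  simpa using hc.arcIntegral_mul_sq_le hf hh

end ClosedImmersed

/-! ### Energy estimates -/

/-- The numerical relations between `L²` norms `a, x₁, x₂, x₃` of a function and its derivatives
and a bound `m` for its supremum. -/
structure Interpolation (L a x₁ x₂ x₃ m : ℝ) : Prop where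
  one_le : 1 ≤ L
  a_nonneg : 0 ≤ a
  x₁_nonneg : 0 ≤ x₁
  x₂_nonneg : 0 ≤ x₂
  x₃_nonneg : 0 ≤ x₃
  m_nonneg : 0 ≤ m
  sq_x₁_le : x₁ ^ 2 ≤ a * x₂
  sq_x₂_le : x₂ ^ 2 ≤ x₁ * x₃
  x₁_le : x₁ ≤ L * x₂
  x₂_le : x₂ ≤ L * x₃
  sq_m_le_mul : m ^ 2 ≤ 2 * a * x₁
  sq_m_le : m ^ 2 ≤ L * x₁ ^ 2

namespace Interpolation

variable {L a x₁ x₂ x₃ m : ℝ} (h : Interpolation L a x₁ x₂ x₃ m)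
include h

theorem cube_x₁_le : x₁ ^ 3 ≤ a * L * x₂ ^ 2 := by
  have := mul_le_mul h.x₁_le h.sq_x₁_le (sq_nonneg _) (h.x₁_nonneg.trans h.x₁_le)
  linarith

theorem m_mul_sq_x₁_le : m * x₁ ^ 2 ≤ 2 * a * L ^ 2 * x₂ ^ 2 := by
  have hL : 0 ≤ L := zero_le_one.trans h.one_le
  have ha := h.a_nonneg
  have hx := h.x₁_nonneg
  refine (abs_le_of_sq_le_sq' ?_ (by positivity)).2
  have h1 : m ^ 2 * x₁ ^ 4 ≤ 2 * a * x₁ * x₁ ^ 4 :=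
    mul_le_mul_of_nonneg_right h.sq_m_le_mul (by positivity)
  have h2 : x₁ ^ 3 * x₁ ^ 2 ≤ (a * L * x₂ ^ 2) * (L * x₂) ^ 2 :=
    mul_le_mul h.cube_x₁_le (pow_le_pow_left₀ hx h.x₁_le 2) (by positivity) (by positivity)
  have h3 : L ^ 3 * (a ^ 2 * x₂ ^ 4) ≤ L ^ 4 * (a ^ 2 * x₂ ^ 4) :=
    mul_le_mul_of_nonneg_right (pow_le_pow_right₀ h.one_le (by norm_num)) (by positivity)
  have h4 : 0 ≤ L ^ 4 * (a ^ 2 * x₂ ^ 4) := by positivity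
  have h5 := mul_le_mul_of_nonneg_left h2 (by positivity : 0 ≤ 2 * a)
  nlinarith

theorem sq_m_mul_sq_x₁_le : m ^ 2 * x₁ ^ 2 ≤ 2 * a ^ 2 * L * x₂ ^ 2 := by
  have ha := h.a_nonneg
  have h1 := mul_le_mul_of_nonneg_right h.sq_m_le_mul (sq_nonneg x₁)
  have h2 := mul_le_mul_of_nonneg_left h.cube_x₁_le (by positivity : 0 ≤ 2 * a)
  nlinarith

theorem m_mul_sq_x₂_le : m * x₂ ^ 2 ≤ 2 * a * L ^ 2 * x₃ ^ 2 := by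
  have hL : 0 ≤ L := zero_le_one.trans h.one_le
  have ha := h.a_nonneg
  have hx := h.x₁_nonneg
  have hx₂ := h.x₂_nonneg
  have hx₃ := h.x₃_nonneg
  refine (abs_le_of_sq_le_sq' ?_ (by positivity)).2
  have h1 : m ^ 2 * (x₂ ^ 2) ^ 2 ≤ 2 * a * x₁ * (x₁ * x₃) ^ 2 :=
    mul_le_mul h.sq_m_le_mul (pow_le_pow_left₀ (sq_nonneg _) h.sq_x₂_le 2) (by positivity)
      (by positivity)
  have h2 : x₁ ^ 3 ≤ a * L * (L * x₃) ^ 2 := h.cube_x₁_le.trans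
    (mul_le_mul_of_nonneg_left (pow_le_pow_left₀ hx₂ h.x₂_le 2) (by positivity))
  have h3 : L ^ 3 * (a ^ 2 * x₃ ^ 4) ≤ L ^ 4 * (a ^ 2 * x₃ ^ 4) :=
    mul_le_mul_of_nonneg_right (pow_le_pow_right₀ h.one_le (by norm_num)) (by positivity)
  have h4 : 0 ≤ L ^ 4 * (a ^ 2 * x₃ ^ 4) := by positivity
  have h5 := mul_le_mul_of_nonneg_left h2 (by positivity : 0 ≤ 2 * a * x₃ ^ 2)
  nlinarith

theorem sq_m_mul_sq_x₂_le : m ^ 2 * x₂ ^ 2 ≤ 2 * a ^ 2 * L * x₃ ^ 2 := by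
  have ha := h.a_nonneg
  have hx₃ := h.x₃_nonneg
  have hx₂ := h.x₂_nonneg
  have h1 : m ^ 2 * x₂ ^ 2 ≤ 2 * a * x₁ * (x₁ * x₃) :=
    mul_le_mul h.sq_m_le_mul h.sq_x₂_le (by positivity) (by have := h.x₁_nonneg; positivity)
  have h2 := mul_le_mul_of_nonneg_left h.sq_x₁_le (by positivity : 0 ≤ 2 * a * x₃)
  have h3 := mul_le_mul_of_nonneg_left h.x₂_le (by positivity : 0 ≤ 2 * a ^ 2 * x₃)
  nlinarith

theorem a_mul_pow_le (ha : a * (400 * L ^ 4) ≤ 1) {n : ℕ} (hn : n ≤ 4) :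
    a * L ^ n ≤ 1 / 400 := by
  have := mul_le_mul_of_nonneg_left (pow_le_pow_right₀ h.one_le hn) h.a_nonneg
  linarith

/-- Smallness of `a` makes the cubic and higher order terms negligible against the negative
definite form `-4 x₂² + 10 x₁² - 8 a²`, in which `x₁² ≤ a x₂`. -/
theorem energy_form_le (ha : a * (400 * L ^ 4) ≤ 1) :
    -4 * x₂ ^ 2 + 12 * (1 + 2 * m + m ^ 2) * x₁ ^ 2 + (-9 + 16 * m) * a ^ 2 - 2 * x₁ ^ 2
      + (1 + (8 + 3 * m ^ 2) * a ^ 2) * a ^ 2 ≤ -(1 / 2) * a ^ 2 := by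
  have hL := h.one_le
  have h0 := h.a_nonneg
  have ha1 : a ≤ 1 / 400 := by simpa using h.a_mul_pow_le ha (n := 0) (by norm_num)
  have e1 : a * L ^ 2 ≤ 1 / 400 := h.a_mul_pow_le ha (by norm_num)
  have e2 : a * L ≤ 1 / 400 := by simpa using h.a_mul_pow_le ha (n := 1) (by norm_num)
  have e3 : a * L ^ 3 ≤ 1 / 400 := h.a_mul_pow_le ha (by norm_num)
  have hX := sq_nonneg x₂
  have t1 : m * x₁ ^ 2 ≤ 2 * (1 / 400) * x₂ ^ 2 := by
    have := mul_le_mul_of_nonneg_right e1 hX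
    linarith [h.m_mul_sq_x₁_le]
  have t2 : m ^ 2 * x₁ ^ 2 ≤ 2 * (1 / 400) * x₂ ^ 2 := by
    have h1 : a ^ 2 * L ≤ 1 / 400 := by nlinarith
    have := mul_le_mul_of_nonneg_right h1 hX
    linarith [h.sq_m_mul_sq_x₁_le]
  have hm : m ^ 2 ≤ L ^ 3 * x₂ ^ 2 := by
    have h1 := pow_le_pow_left₀ h.x₁_nonneg h.x₁_le 2
    have h2 := mul_le_mul_of_nonneg_left h1 (zero_le_one.trans hL)
    linarith [h.sq_m_le]
  have ham : a * m ^ 2 ≤ 1 / 400 * x₂ ^ 2 := by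
    have h1 := mul_le_mul_of_nonneg_left hm h0
    have h2 := mul_le_mul_of_nonneg_right e3 hX
    linarith
  have t3 : m * a ^ 2 ≤ 1 / 800 * x₂ ^ 2 + 1 / 800 * a ^ 2 := by
    have h1 := mul_nonneg h0 (sq_nonneg (m - a))
    have h2 := mul_le_mul_of_nonneg_right ha1 (sq_nonneg a)
    linarith
  have t4 : a ^ 2 * a ^ 2 ≤ 1 / 400 * a ^ 2 :=
    mul_le_mul_of_nonneg_right (by nlinarith) (sq_nonneg a)
  have t5 : m ^ 2 * a ^ 2 * a ^ 2 ≤ 1 / 400 * x₂ ^ 2 := by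
    have h1 : a ^ 3 ≤ 1 := pow_le_one₀ h0 (by linarith)
    have h2 : 0 ≤ a * m ^ 2 := mul_nonneg h0 (sq_nonneg m)
    have h3 := mul_le_mul_of_nonneg_right h1 h2
    linarith
  have h6 := h.sq_x₁_le
  -- `(7 x₂ - 10 a)² / 14 = (7/2) x₂² - 10 a x₂ + (50/7) a²` leaves room for the error terms.
  have h7 := sq_nonneg (7 * x₂ - 10 * a)
  have h8 := sq_nonneg a
  linarith

/-- The estimate corresponding to `energy_form_le` one derivative higher. -/
theorem energy_form_deriv_le (ha : a * (400 * L ^ 4) ≤ 1) :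
    -4 * x₃ ^ 2 + 10 * (1 + 2 * m + m ^ 2) * x₂ ^ 2 - 11 * (1 - 4 * m) * x₁ ^ 2
      + 3 * (1 + (8 + 3 * m ^ 2) * a ^ 2) * x₁ ^ 2 ≤ -(1 / 2) * x₁ ^ 2 := by
  have hL := h.one_le
  have h0 := h.a_nonneg
  have ha1 : a ≤ 1 / 400 := by simpa using h.a_mul_pow_le ha (n := 0) (by norm_num)
  have e1 : a * L ^ 2 ≤ 1 / 400 := h.a_mul_pow_le ha (by norm_num)
  have e2 : a * L ≤ 1 / 400 := by simpa using h.a_mul_pow_le ha (n := 1) (by norm_num)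
  have hX := sq_nonneg x₃
  have t1 : m * x₂ ^ 2 ≤ 2 * (1 / 400) * x₃ ^ 2 := by
    have := mul_le_mul_of_nonneg_right e1 hX
    linarith [h.m_mul_sq_x₂_le]
  have t2 : m ^ 2 * x₂ ^ 2 ≤ 2 * (1 / 400) * x₃ ^ 2 := by
    have h1 : a ^ 2 * L ≤ 1 / 400 := by nlinarith
    have := mul_le_mul_of_nonneg_right h1 hX
    linarith [h.sq_m_mul_sq_x₂_le]
  have p2 : x₂ ^ 2 ≤ L ^ 2 * x₃ ^ 2 := by
    rw [← mul_pow]; exact pow_le_pow_left₀ h.x₂_nonneg h.x₂_le 2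
  have p1 : x₁ ^ 2 ≤ L ^ 2 * x₂ ^ 2 := by
    rw [← mul_pow]; exact pow_le_pow_left₀ h.x₁_nonneg h.x₁_le 2
  have t3 : m * x₁ ^ 2 ≤ 2 * (1 / 400) * x₃ ^ 2 := by
    have h1 := mul_le_mul_of_nonneg_left p2 (by positivity : 0 ≤ 2 * a * L ^ 2)
    have h2 := mul_le_mul_of_nonneg_right (by linarith : a * L ^ 4 ≤ 1 / 400) hX
    linarith [h.m_mul_sq_x₁_le]
  have t4 : a ^ 2 * x₁ ^ 2 ≤ 1 / 400 * x₁ ^ 2 :=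
    mul_le_mul_of_nonneg_right (by nlinarith) (sq_nonneg x₁)
  have t5 : m ^ 2 * a ^ 2 * x₁ ^ 2 ≤ 2 * (1 / 400) * x₃ ^ 2 := by
    have h1 : m ^ 2 * x₁ ^ 2 ≤ 2 * (1 / 400) * (L ^ 2 * x₃ ^ 2) := by
      have h1 : a ^ 2 * L ≤ 1 / 400 := by nlinarith
      have := mul_le_mul_of_nonneg_right h1 (sq_nonneg x₂)
      linarith [h.sq_m_mul_sq_x₁_le]
    have h2 : a ^ 2 * L ^ 2 ≤ 1 := by nlinarith
    have h3 := mul_le_mul_of_nonneg_left h1 (sq_nonneg a)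
    have h4 := mul_le_mul_of_nonneg_right h2 hX
    linarith
  have h6 := h.sq_x₂_le
  have h7 := sq_nonneg (7 * x₃ - 10 * x₁)
  have h8 := sq_nonneg x₁
  linarith

end Interpolation

namespace ClosedImmersed

variable {c : ℝ → ℂ} (hc : ClosedImmersed c)
include hc

theorem ksNormSq_nonneg : 0 ≤ ksNormSq c := hc.arcIntegral_nonneg fun _ => sq_nonneg _

theorem arcIntegral_curvature_sub_one (hk : arcIntegral c (curvature c) = length c) :
    arcIntegral c (fun u => curvature c u - 1) = 0 := by
  have h1 := hc.arcIntegral_add (f := curvature c) (g := fun _ => -1)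
    hc.contDiff_curvature.continuous continuous_const
  rw [arcIntegral_const, hk] at h1
  simp only [sub_eq_add_neg, h1]
  ring

theorem arcIntegral_curvature_sq (hk : arcIntegral c (curvature c) = length c) :
    arcIntegral c (fun u => curvature c u ^ 2) =
      length c + arcIntegral c (fun u => (curvature c u - 1) ^ 2) := by
  have h0 := hc.arcIntegral_curvature_sub_one hk
  have ck := hc.contDiff_curvature.continuous
  have h1 : arcIntegral c (fun u => curvature c u ^ 2) = arcIntegral c
      (fun u => (curvature c u - 1) ^ 2 + (2 * (curvature c u - 1) + 1)) := by
    congr 1; ext u; ring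
  rw [h1, hc.arcIntegral_add (by fun_prop) (by fun_prop), hc.arcIntegral_add (by fun_prop)
    (by fun_prop), arcIntegral_const_mul, h0, ← length]
  ring

/-- On a closed curve of mean curvature `1`, the quantities in the energy estimates satisfy the
relations of `Interpolation`. -/
theorem exists_interpolation (hk : arcIntegral c (curvature c) = length c) (hL : 1 ≤ length c) :
    ∃ m, (∀ u, |curvature c u - 1| ≤ m) ∧
      Interpolation (length c) √(arcIntegral c fun u => (curvature c u - 1) ^ 2) √(ksNormSq c)
        √(arcIntegral c fun u => curvatureSS c u ^ 2)
        √(arcIntegral c fun u => arcDeriv c (curvatureSS c) u ^ 2) m := by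
  have h0 := hc.arcIntegral_curvature_sub_one hk
  have sk3 := hc.contDiff_arcDeriv hc.contDiff_curvatureSS
  have ck1 := hc.contDiff_curvatureS.continuous
  have ck2 := hc.contDiff_curvatureSS.continuous
  have df : HasArcDeriv c (fun u => curvature c u - 1) (curvatureS c) :=
    hc.hasArcDeriv_curvature.sub_const 1
  have pf : Function.Periodic (fun u => curvature c u - 1) (2 * Real.pi) := fun u => by
    simp only [hc.periodic_curvature u]
  have dk1 := hc.hasArcDeriv_curvatureS
  have dk2 := hc.hasArcDeriv_curvatureSS
  have pk1 := hc.periodic_curvatureS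
  have pk2 := hc.periodic_curvatureSS
  have m1 : arcIntegral c (curvatureS c) = 0 := hc.arcIntegral_of_hasArcDeriv df ck1 pf
  have m2 : arcIntegral c (curvatureSS c) = 0 := hc.arcIntegral_of_hasArcDeriv dk1 ck2 pk1
  have s1 := hc.sq_le_length_mul df ck1 pf h0
  have s2 := hc.pow_four_le_mul df ck1 pf h0
  have i1 := hc.sq_arcIntegral_sq_le df dk1 ck2 pf pk1
  have i2 := hc.sq_arcIntegral_sq_le dk1 dk2 sk3.continuous pk1 pk2
  have p1 := hc.arcIntegral_sq_le dk1 ck2 pk1 m1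
  have p2 := hc.arcIntegral_sq_le dk2 sk3.continuous pk2 m2
  have n0 : 0 ≤ arcIntegral c (fun u => (curvature c u - 1) ^ 2) :=
    hc.arcIntegral_nonneg fun _ => sq_nonneg _
  have n1 : 0 ≤ arcIntegral c (fun u => curvatureS c u ^ 2) :=
    hc.arcIntegral_nonneg fun _ => sq_nonneg _
  have n2 : 0 ≤ arcIntegral c (fun u => curvatureSS c u ^ 2) :=
    hc.arcIntegral_nonneg fun _ => sq_nonneg _
  have n3 : 0 ≤ arcIntegral c (fun u => arcDeriv c (curvatureSS c) u ^ 2) :=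
    hc.arcIntegral_nonneg fun _ => sq_nonneg _
  rw [ksNormSq]
  set A := arcIntegral c fun u => (curvature c u - 1) ^ 2
  set X₁ := arcIntegral c fun u => curvatureS c u ^ 2
  set X₂ := arcIntegral c fun u => curvatureSS c u ^ 2
  set X₃ := arcIntegral c fun u => arcDeriv c (curvatureSS c) u ^ 2
  have hL0 : 0 ≤ length c := zero_le_one.trans hL
  have e : 2 * √A * √X₁ = √(4 * (A * X₁)) := by
    rw [Real.sqrt_mul (by norm_num), Real.sqrt_mul n0, show (4 : ℝ) = 2 ^ 2 by norm_num,
      Real.sqrt_sq (by norm_num), mul_assoc]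
  refine ⟨min √(length c * X₁) √√(4 * (A * X₁)), fun u => le_min ?_ ?_, ?_⟩
  · exact Real.abs_le_sqrt (s1 u)
  · refine Real.abs_le_sqrt (Real.le_sqrt_of_sq_le ?_)
    rw [← pow_mul]
    exact s2 u
  · refine ⟨hL, by positivity, by positivity, by positivity, by positivity, by positivity,
      ?_, ?_, ?_, ?_, ?_, ?_⟩
    · rw [Real.sq_sqrt n1, ← Real.sqrt_mul n0]
      exact Real.le_sqrt_of_sq_le i1
    · rw [Real.sq_sqrt n2, ← Real.sqrt_mul n1]
      exact Real.le_sqrt_of_sq_le i2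
    · rw [← Real.sqrt_sq hL0, ← Real.sqrt_mul (sq_nonneg _)]
      exact Real.sqrt_le_sqrt p1
    · rw [← Real.sqrt_sq hL0, ← Real.sqrt_mul (sq_nonneg _)]
      exact Real.sqrt_le_sqrt p2
    · rw [e]
      refine (pow_le_pow_left₀ (by positivity) (min_le_right _ _) 2).trans ?_
      rw [Real.sq_sqrt (Real.sqrt_nonneg _)]
    · refine (pow_le_pow_left₀ (by positivity) (min_le_left _ _) 2).trans ?_
      rw [Real.sq_sqrt (by positivity), Real.sq_sqrt n1]

theorem neg_rescalingFactor_le (hk : arcIntegral c (curvature c) = length c) (hL : 1 ≤ length c)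
    {m : ℝ} (hm : ∀ u, |curvature c u - 1| ≤ m) :
    -rescalingFactor c ≤
      1 + (8 + 3 * m ^ 2) * arcIntegral c (fun u => (curvature c u - 1) ^ 2) := by
  have ck := hc.contDiff_curvature.continuous
  have h0 := hc.arcIntegral_curvature_sub_one hk
  have h1 : arcIntegral c (fun u => curvature c u ^ 4) ≤ arcIntegral c
      (fun u => 1 + (4 * (curvature c u - 1) + (8 + 3 * m ^ 2) * (curvature c u - 1) ^ 2)) := by
    refine hc.arcIntegral_mono (by fun_prop) (by fun_prop) fun u => ?_
    have h2 : (curvature c u - 1) ^ 2 ≤ m ^ 2 := sq_le_sq' (abs_le.1 (hm u)).1 (abs_le.1 (hm u)).2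
    have h3 := mul_le_mul_of_nonneg_right h2 (sq_nonneg (curvature c u - 1))
    nlinarith [sq_nonneg ((curvature c u - 1) * (curvature c u - 2))]
  rw [hc.arcIntegral_add (by fun_prop) (by fun_prop), hc.arcIntegral_add (by fun_prop)
    (by fun_prop), arcIntegral_const_mul, arcIntegral_const_mul, h0, ← length] at h1
  have hA : 0 ≤ arcIntegral c (fun u => (curvature c u - 1) ^ 2) :=
    hc.arcIntegral_nonneg fun _ => sq_nonneg _
  have hM := hc.ksNormSq_nonneg
  have hL0 : 0 < length c := hc.length_pos
  have h4 : 0 ≤ (8 + 3 * m ^ 2) * arcIntegral c (fun u => (curvature c u - 1) ^ 2) := by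
    positivity
  rw [rescalingFactor, neg_le_iff_add_nonneg, ← mul_nonneg_iff_of_pos_left hL0, mul_add,
    mul_inv_cancel_left₀ hL0.ne']
  nlinarith

/-- If the mean curvature is `1` and the curvature is `L²`-close to it, the elastic energy decreases
strictly, unless the curvature is constant. -/
theorem energy_dissipation (hk : arcIntegral c (curvature c) = length c) (hL : 1 ≤ length c)
    (hsmall : √(arcIntegral c fun u => (curvature c u - 1) ^ 2) * (400 * length c ^ 4) ≤ 1) :
    arcIntegral c (fun u => -4 * curvatureSS c u ^ 2 + 12 * curvature c u ^ 2 * curvatureS c u ^ 2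
      - curvature c u ^ 6 - rescalingFactor c * curvature c u ^ 2) ≤
      -(1 / 2) * arcIntegral c (fun u => (curvature c u - 1) ^ 2) := by
  have ck := hc.contDiff_curvature.continuous
  have ck1 := hc.contDiff_curvatureS.continuous
  have ck2 := hc.contDiff_curvatureSS.continuous
  obtain ⟨m, hm, hI⟩ := hc.exists_interpolation hk hL
  have hl := hc.neg_rescalingFactor_le hk hL hm
  have h0 := hc.arcIntegral_curvature_sub_one hk
  have hs := hc.arcIntegral_curvature_sq hk
  have hA : 0 ≤ arcIntegral c (fun u => (curvature c u - 1) ^ 2) :=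
    hc.arcIntegral_nonneg fun _ => sq_nonneg _
  have hX₂ : 0 ≤ arcIntegral c (fun u => curvatureSS c u ^ 2) :=
    hc.arcIntegral_nonneg fun _ => sq_nonneg _
  have hform := hI.energy_form_le hsmall
  rw [Real.sq_sqrt hA, Real.sq_sqrt hX₂, Real.sq_sqrt hc.ksNormSq_nonneg] at hform
  have hlL : rescalingFactor c * length c =
      2 * ksNormSq c - arcIntegral c (fun u => curvature c u ^ 4) := by
    rw [rescalingFactor]
    field_simp [hc.length_pos.ne']
  have h1 : arcIntegral c (fun u => -4 * curvatureSS c u ^ 2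
      + 12 * curvature c u ^ 2 * curvatureS c u ^ 2
      - curvature c u ^ 6 - rescalingFactor c * curvature c u ^ 2) ≤
      arcIntegral c (fun u => -4 * curvatureSS c u ^ 2
        + (12 * (1 + 2 * m + m ^ 2) * curvatureS c u ^ 2 + (-2 * (curvature c u - 1)
        + ((-9 + 16 * m) * (curvature c u - 1) ^ 2 + (-1 * curvature c u ^ 4
        + -rescalingFactor c * curvature c u ^ 2))))) := by
    refine hc.arcIntegral_mono (by fun_prop) (by fun_prop) fun u => ?_
    obtain ⟨b1, b2⟩ := abs_le.1 (hm u)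
    set f := curvature c u - 1 with hf
    have e : curvature c u = 1 + f := by rw [hf]; ring
    have h2 : f ^ 2 ≤ m ^ 2 := sq_le_sq' b1 b2
    have h3 : curvature c u ^ 2 ≤ 1 + 2 * m + m ^ 2 := by rw [e]; linarith
    have h4 := mul_le_mul_of_nonneg_right h3 (sq_nonneg (curvatureS c u))
    -- This is `k⁴ - k⁶ ≤ -2 f + (-9 + 16 m) f²`; the linear term has integral zero.
    have h5 : 0 ≤ (16 * (m + f) + f ^ 2 * (14 + 6 * f + f ^ 2)) * f ^ 2 :=
      mul_nonneg (add_nonneg (by linarith) (mul_nonneg (sq_nonneg _)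
        (by nlinarith [sq_nonneg (f + 3)]))) (sq_nonneg _)
    rw [e] at h4 ⊢
    linarith
  rw [hc.arcIntegral_add (by fun_prop) (by fun_prop), hc.arcIntegral_add (by fun_prop)
    (by fun_prop), hc.arcIntegral_add (by fun_prop) (by fun_prop), hc.arcIntegral_add
    (by fun_prop) (by fun_prop), hc.arcIntegral_add (by fun_prop) (by fun_prop)] at h1
  simp only [arcIntegral_const_mul] at h1
  rw [h0, hs, ← ksNormSq] at h1
  have h6 := mul_le_mul_of_nonneg_right hl hA
  linarith

/-- Under the assumptions of `energy_dissipation`, `‖k_s‖₂²` decays at a definite rate. -/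
theorem ksNormSq_dissipation (hk : arcIntegral c (curvature c) = length c) (hL : 1 ≤ length c)
    (hsmall : √(arcIntegral c fun u => (curvature c u - 1) ^ 2) * (400 * length c ^ 4) ≤ 1) :
    arcIntegral c (fun u => -4 * arcDeriv c (curvatureSS c) u ^ 2
      + 10 * curvature c u ^ 2 * curvatureSS c u ^ 2 - 10 / 3 * curvatureS c u ^ 4
      - 11 * curvature c u ^ 4 * curvatureS c u ^ 2
      - 3 * rescalingFactor c * curvatureS c u ^ 2) ≤ -(1 / 2) * ksNormSq c := by
  have ck := hc.contDiff_curvature.continuous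
  have ck1 := hc.contDiff_curvatureS.continuous
  have ck2 := hc.contDiff_curvatureSS.continuous
  have ck3 := (hc.contDiff_arcDeriv hc.contDiff_curvatureSS).continuous
  obtain ⟨m, hm, hI⟩ := hc.exists_interpolation hk hL
  have hl := hc.neg_rescalingFactor_le hk hL hm
  have hA : 0 ≤ arcIntegral c (fun u => (curvature c u - 1) ^ 2) :=
    hc.arcIntegral_nonneg fun _ => sq_nonneg _
  have hX₂ : 0 ≤ arcIntegral c (fun u => curvatureSS c u ^ 2) :=
    hc.arcIntegral_nonneg fun _ => sq_nonneg _
  have hX₃ : 0 ≤ arcIntegral c (fun u => arcDeriv c (curvatureSS c) u ^ 2) :=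
    hc.arcIntegral_nonneg fun _ => sq_nonneg _
  have hform := hI.energy_form_deriv_le hsmall
  rw [Real.sq_sqrt hA, Real.sq_sqrt hX₂, Real.sq_sqrt hX₃, Real.sq_sqrt hc.ksNormSq_nonneg] at hform
  have h1 : arcIntegral c (fun u => -4 * arcDeriv c (curvatureSS c) u ^ 2
      + 10 * curvature c u ^ 2 * curvatureSS c u ^ 2 - 10 / 3 * curvatureS c u ^ 4
      - 11 * curvature c u ^ 4 * curvatureS c u ^ 2
      - 3 * rescalingFactor c * curvatureS c u ^ 2) ≤
      arcIntegral c (fun u => -4 * arcDeriv c (curvatureSS c) u ^ 2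
        + (10 * (1 + 2 * m + m ^ 2) * curvatureSS c u ^ 2
        + (-(11 * (1 - 4 * m)) - 3 * rescalingFactor c) * curvatureS c u ^ 2)) := by
    refine hc.arcIntegral_mono (by fun_prop) (by fun_prop) fun u => ?_
    obtain ⟨b1, b2⟩ := abs_le.1 (hm u)
    set f := curvature c u - 1 with hf
    have e : curvature c u = 1 + f := by rw [hf]; ring
    have h2 : f ^ 2 ≤ m ^ 2 := sq_le_sq' b1 b2
    have h3 : curvature c u ^ 2 ≤ 1 + 2 * m + m ^ 2 := by rw [e]; linarith
    have h4 := mul_le_mul_of_nonneg_right h3 (sq_nonneg (curvatureSS c u))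
    have h5 : 1 - 4 * m ≤ curvature c u ^ 4 := by
      rw [e]; nlinarith [sq_nonneg (f * (f + 2)), sq_nonneg f]
    have h6 := mul_le_mul_of_nonneg_right h5 (sq_nonneg (curvatureS c u))
    have h7 : 0 ≤ curvatureS c u ^ 4 := by positivity
    linarith
  rw [hc.arcIntegral_add (by fun_prop) (by fun_prop), hc.arcIntegral_add (by fun_prop)
    (by fun_prop)] at h1
  simp only [arcIntegral_const_mul] at h1
  rw [← ksNormSq] at h1
  have h6 := mul_le_mul_of_nonneg_right hl hc.ksNormSq_nonneg
  linarith

end ClosedImmersed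

/-! ### Differential inequalities -/

theorem eq_of_hasDerivAt_zero {f : ℝ → ℝ} {a b : ℝ} (hf : ContinuousOn f (Icc a b))
    (hf' : ∀ r ∈ Ioo a b, HasDerivAt f 0 r) {r : ℝ} (hr : r ∈ Icc a b) : f r = f a := by
  have ha : a ∈ Icc a b := ⟨le_rfl, hr.1.trans hr.2⟩
  have hd : DifferentiableOn ℝ f (interior (Icc a b)) := fun x hx =>
    (hf' x (by rwa [interior_Icc] at hx)).differentiableAt.differentiableWithinAt
  have h0 : ∀ x ∈ interior (Icc a b), deriv f x = 0 := fun x hx =>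
    (hf' x (by rwa [interior_Icc] at hx)).deriv
  exact le_antisymm
    (antitoneOn_of_deriv_nonpos (convex_Icc a b) hf hd (fun x hx => (h0 x hx).le) ha hr hr.1)
    (monotoneOn_of_deriv_nonneg (convex_Icc a b) hf hd (fun x hx => (h0 x hx).ge) ha hr hr.1)

/-- A function that starts below a level and decreases strictly whenever it meets that level
stays below it. No differentiability is needed at the initial time. -/
theorem le_of_forall_eq_imp_deriv_neg {f f' : ℝ → ℝ} {a b η : ℝ} (hf : ContinuousOn f (Icc a b))
    (hf' : ∀ r ∈ Ioo a b, HasDerivAt f (f' r) r) (ha : f a < η)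
    (hneg : ∀ r ∈ Ioo a b, f r = η → f' r < 0) {r : ℝ} (hr : r ∈ Icc a b) : f r ≤ η := by
  rcases hr.1.eq_or_lt with rfl | har
  · exact ha.le
  have h1 : ∀ᶠ s in 𝓝[>] a, f s < η := by
    have h2 : ContinuousWithinAt f (Icc a b) a := hf a ⟨le_rfl, hr.1.trans hr.2⟩
    have h3 := h2.eventually_lt_const ha
    have h4 : 𝓝[>] a ≤ 𝓝[Icc a b] a := by
      rw [← nhdsWithin_Ioo_eq_nhdsGT (har.trans_le hr.2)]
      exact nhdsWithin_mono a Ioo_subset_Icc_self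
    exact h4 h3
  obtain ⟨s, hs, hsr⟩ := (h1.and (Ioo_mem_nhdsGT har)).exists
  refine image_le_of_deriv_right_lt_deriv_boundary (a := s) (b := b) (f := f) (f' := f')
    (B := fun _ => η) (B' := fun _ => 0) (hf.mono (Icc_subset_Icc_left hsr.1.le))
    (fun x hx => (hf' x ⟨hsr.1.trans_le hx.1, hx.2⟩).hasDerivWithinAt) hs.le
    (fun x => hasDerivAt_const x η) (fun x hx => hneg x ⟨hsr.1.trans_le hx.1, hx.2⟩)
    ⟨hsr.2.le, hr.2⟩

theorem le_mul_exp_of_deriv_le {f f' : ℝ → ℝ} {a β : ℝ} (ha : 0 ≤ a)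
    (hf : ContinuousOn f (Icc 0 a)) (hf' : ∀ r ∈ Ioo 0 a, HasDerivAt f (f' r) r)
    (hle : ∀ r ∈ Ioo 0 a, f' r ≤ -β * f r) : f a ≤ f 0 * Real.exp (-β * a) := by
  have hd : ∀ r ∈ Ioo 0 a, HasDerivAt (fun r => f r * Real.exp (β * r))
      (f' r * Real.exp (β * r) + f r * (Real.exp (β * r) * β)) r := fun r hr =>
    (hf' r hr).mul (((hasDerivAt_id r).const_mul β).exp.congr_deriv (by simp))
  have h := antitoneOn_of_deriv_nonpos (convex_Icc 0 a) (f := fun r => f r * Real.exp (β * r))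
    (hf.mul (by fun_prop))
    (fun r hr => (hd r (by rwa [interior_Icc] at hr)).differentiableAt.differentiableWithinAt)
    (fun r hr => by
      rw [interior_Icc] at hr
      rw [(hd r hr).deriv]
      nlinarith [hle r hr, Real.exp_pos (β * r)])
    (left_mem_Icc.2 ha) (right_mem_Icc.2 ha) ha
  simp only [mul_zero, Real.exp_zero, mul_one] at h
  rw [neg_mul, Real.exp_neg, ← div_eq_mul_inv, le_div_iff₀ (Real.exp_pos _)]
  exact h

/-! ### Long-time behaviour of the flow -/

namespace IsRescaledFlow

variable {T : EReal} {γ : ℝ → ℝ → ℂ} (h : IsRescaledFlow T γ) {b : ℝ} (hb : (b : EReal) < T)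
include h

theorem closedImmersed {t : ℝ} (ht : t ∈ timeInterval T) : ClosedImmersed (γ t) where
  smooth := SmoothOnStrip.contDiff (F := γ) h.smooth ht
  closed := h.closed t ht
  immersed := h.immersed t ht

include hb

omit h in
theorem Icc_subset_timeInterval : Icc 0 b ⊆ timeInterval T := fun _ hr =>
  ⟨hr.1, (EReal.coe_le_coe_iff.2 hr.2).trans_lt hb⟩

theorem isNormalVariation :
    IsNormalVariation (Ioo 0 b) γ fun t => normalSpeed (rescalingFactor (γ t)) (γ t) where
  isOpen := isOpen_Ioo
  smooth := SmoothOnStrip.mono h.smooth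
    (Ioo_subset_Icc_self.trans (Icc_subset_timeInterval hb))
  closedImmersed _ ht :=
    h.closedImmersed (Icc_subset_timeInterval hb (Ioo_subset_Icc_self ht))
  evolution t ht u :=
    (h.evolution t (Icc_subset_timeInterval hb (Ioo_subset_Icc_self ht)) u).hasDerivAt
      (Filter.mem_of_superset (Icc_mem_nhds ht.1 ht.2) (Icc_subset_timeInterval hb))

variable (h0 : 0 < b)
include h0

theorem continuousOn_arcIntegral {F : ℝ → ℝ → ℝ} (hF : SmoothOnStrip (Icc 0 b) F) :
    ContinuousOn (fun t => arcIntegral (γ t) (F t)) (Icc 0 b) :=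
  FreeElastic.continuousOn_arcIntegral (uniqueDiffOn_Icc h0)
    (SmoothOnStrip.mono h.smooth (Icc_subset_timeInterval hb))
    (fun _ ht => h.closedImmersed (Icc_subset_timeInterval hb ht)) hF

theorem smoothOnStrip_curvature : SmoothOnStrip (Icc 0 b) fun t => curvature (γ t) :=
  FreeElastic.smoothOnStrip_curvature (uniqueDiffOn_Icc h0)
    (SmoothOnStrip.mono h.smooth (Icc_subset_timeInterval hb))
    (fun _ ht => h.closedImmersed (Icc_subset_timeInterval hb ht))

theorem smoothOnStrip_curvatureS : SmoothOnStrip (Icc 0 b) fun t => curvatureS (γ t) :=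
  FreeElastic.smoothOnStrip_curvatureS (uniqueDiffOn_Icc h0)
    (SmoothOnStrip.mono h.smooth (Icc_subset_timeInterval hb))
    (fun _ ht => h.closedImmersed (Icc_subset_timeInterval hb ht))

/-- The factor `λ` is chosen so that the flow preserves the length. -/
theorem length_eq {t : ℝ} (ht : t ∈ Icc 0 b) : length (γ t) = length (γ 0) := by
  refine eq_of_hasDerivAt_zero (f := fun t => length (γ t))
    (h.continuousOn_arcIntegral hb h0 (F := fun _ _ => 1) contDiffOn_const) (fun r hr => ?_) ht
  have hv := h.isNormalVariation hb
  have hc := hv.closedImmersed r hr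
  refine (hv.hasDerivAt_arcIntegral hr (F := fun _ _ => 1) contDiffOn_const
    (G := fun _ => 0) fun w => hasDerivAt_const r 1).congr_deriv ?_
  rw [hc.arcIntegral_curvature_mul_normalSpeed, rescalingFactor]
  field_simp [hc.length_pos.ne']
  ring

theorem arcIntegral_curvature_eq {t : ℝ} (ht : t ∈ Icc 0 b) :
    arcIntegral (γ t) (curvature (γ t)) = arcIntegral (γ 0) (curvature (γ 0)) := by
  refine eq_of_hasDerivAt_zero (f := fun t => arcIntegral (γ t) (curvature (γ t)))
    (h.continuousOn_arcIntegral hb h0 (h.smoothOnStrip_curvature hb h0)) (fun r hr => ?_) ht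
  have hv := h.isNormalVariation hb
  have hc := hv.closedImmersed r hr
  refine (hv.hasDerivAt_arcIntegral hr
    ((h.smoothOnStrip_curvature hb h0).mono Ioo_subset_Icc_self)
    (hv.hasDerivAt_curvature hr)).congr_deriv ?_
  exact hc.arcIntegral_variation_curvature (hc.contDiff_normalSpeed _) (hc.periodic_normalSpeed _)

omit h0 in
theorem hasDerivAt_energy {t : ℝ} (ht : t ∈ Ioo 0 b) :
    HasDerivAt (fun t => arcIntegral (γ t) fun u => curvature (γ t) u ^ 2)
      (arcIntegral (γ t) fun u => -4 * curvatureSS (γ t) u ^ 2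
        + 12 * curvature (γ t) u ^ 2 * curvatureS (γ t) u ^ 2 - curvature (γ t) u ^ 6
        - rescalingFactor (γ t) * curvature (γ t) u ^ 2) t := by
  have hv := h.isNormalVariation hb
  have hs := FreeElastic.smoothOnStrip_curvature hv.isOpen.uniqueDiffOn hv.smooth hv.closedImmersed
  rw [← (hv.closedImmersed t ht).arcIntegral_variation_curvature_sq]
  exact hv.hasDerivAt_arcIntegral ht (F := fun t u => curvature (γ t) u ^ 2) (ContDiffOn.pow hs 2)
    fun w => ((hv.hasDerivAt_curvature ht w).pow 2).congr_deriv (by push_cast; ring)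

omit h0 in
theorem hasDerivAt_ksNormSq {t : ℝ} (ht : t ∈ Ioo 0 b) :
    HasDerivAt (fun t => ksNormSq (γ t))
      (arcIntegral (γ t) fun u => -4 * arcDeriv (γ t) (curvatureSS (γ t)) u ^ 2
        + 10 * curvature (γ t) u ^ 2 * curvatureSS (γ t) u ^ 2
        - 10 / 3 * curvatureS (γ t) u ^ 4
        - 11 * curvature (γ t) u ^ 4 * curvatureS (γ t) u ^ 2
        - 3 * rescalingFactor (γ t) * curvatureS (γ t) u ^ 2) t := by
  have hv := h.isNormalVariation hb
  have hs := FreeElastic.smoothOnStrip_curvatureS hv.isOpen.uniqueDiffOn hv.smooth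
    hv.closedImmersed
  rw [← (hv.closedImmersed t ht).arcIntegral_variation_curvatureS_sq]
  exact hv.hasDerivAt_arcIntegral ht (F := fun t u => curvatureS (γ t) u ^ 2) (ContDiffOn.pow hs 2)
    fun w => ((hv.hasDerivAt_curvatureS ht w).pow 2).congr_deriv (by push_cast; ring)

/-- A flow of mean curvature `1` whose initial curvature is `L²`-close to `1` keeps this
property. -/
theorem sqrt_arcIntegral_curvature_sub_one_sq_le
    (hk : arcIntegral (γ 0) (curvature (γ 0)) = length (γ 0)) (hL : 1 ≤ length (γ 0)) {δ : ℝ}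
    (hδ : 0 < δ) (hδL : δ * (400 * length (γ 0) ^ 4) ≤ 1)
    (hini : arcIntegral (γ 0) (fun u => (curvature (γ 0) u - 1) ^ 2) < δ ^ 2)
    {t : ℝ} (ht : t ∈ Icc 0 b) :
    √(arcIntegral (γ t) fun u => (curvature (γ t) u - 1) ^ 2) ≤ δ := by
  have hkt : ∀ r ∈ Icc 0 b, arcIntegral (γ r) (curvature (γ r)) = length (γ r) := fun r hr => by
    rw [h.arcIntegral_curvature_eq hb h0 hr, h.length_eq hb h0 hr, hk]
  have he : ∀ r ∈ Icc 0 b, arcIntegral (γ r) (fun u => curvature (γ r) u ^ 2) =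
      length (γ 0) + arcIntegral (γ r) (fun u => (curvature (γ r) u - 1) ^ 2) := fun r hr => by
    rw [(h.closedImmersed (Icc_subset_timeInterval hb hr)).arcIntegral_curvature_sq (hkt r hr),
      h.length_eq hb h0 hr]
  have hz : (0 : ℝ) ∈ Icc 0 b := left_mem_Icc.2 h0.le
  have key := le_of_forall_eq_imp_deriv_neg (η := length (γ 0) + δ ^ 2)
    (h.continuousOn_arcIntegral hb h0 (F := fun t u => curvature (γ t) u ^ 2)
      (ContDiffOn.pow (h.smoothOnStrip_curvature hb h0) 2))
    (fun r hr => h.hasDerivAt_energy hb hr) (by rw [he 0 hz]; linarith) (fun r hr hr' => ?_) ht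
  · rw [he t ht] at key
    rw [← Real.sqrt_sq hδ.le]
    exact Real.sqrt_le_sqrt (by linarith)
  · have hr'' := Ioo_subset_Icc_self hr
    have hc := h.closedImmersed (Icc_subset_timeInterval hb hr'')
    rw [he r hr'', add_right_inj] at hr'
    have hl := h.length_eq hb h0 hr''
    have h1 := hc.energy_dissipation (hkt r hr'') (hl ▸ hL)
      (by rw [hr', Real.sqrt_sq hδ.le, hl]; exact hδL)
    rw [hr'] at h1
    have : 0 < δ ^ 2 := by positivity
    linarith

theorem ksNormSq_le
    (hk : arcIntegral (γ 0) (curvature (γ 0)) = length (γ 0)) (hL : 1 ≤ length (γ 0)) {δ : ℝ}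
    (hδ : 0 < δ) (hδL : δ * (400 * length (γ 0) ^ 4) ≤ 1)
    (hini : arcIntegral (γ 0) (fun u => (curvature (γ 0) u - 1) ^ 2) < δ ^ 2)
    {β : ℝ} (hβ : β ≤ 1 / 2) :
    ksNormSq (γ b) ≤ ksNormSq (γ 0) * Real.exp (-β * b) := by
  refine le_mul_exp_of_deriv_le (f := fun t => ksNormSq (γ t)) h0.le
    (h.continuousOn_arcIntegral hb h0 (F := fun t u => curvatureS (γ t) u ^ 2)
      (ContDiffOn.pow (h.smoothOnStrip_curvatureS hb h0) 2))
    (fun r hr => h.hasDerivAt_ksNormSq hb hr) fun r hr => ?_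
  have hr' := Ioo_subset_Icc_self hr
  have hc := h.closedImmersed (Icc_subset_timeInterval hb hr')
  have hl := h.length_eq hb h0 hr'
  have hsmall := h.sqrt_arcIntegral_curvature_sub_one_sq_le hb h0 hk hL hδ hδL hini hr'
  have h1 := hc.ksNormSq_dissipation
    (by rw [h.arcIntegral_curvature_eq hb h0 hr', hl, hk]) (hl ▸ hL)
    (by
      rw [hl]
      exact (mul_le_mul_of_nonneg_right hsmall (by positivity)).trans hδL)
  have h2 := mul_le_mul_of_nonneg_right hβ hc.ksNormSq_nonneg
  linarith

end IsRescaledFlow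

end FreeElastic

end

theorem proposition3p2 (ω : ℕ) (hω : 0 < ω) :
    ∃ ε₀ : ℝ, 0 < ε₀ ∧ ∃ t₀ : ℝ, 0 ≤ t₀ ∧
      ∀ (T : EReal) (γ : ℝ → ℝ → ℂ), FreeElastic.IsRescaledFlow T γ →
        FreeElastic.turningNumber (γ 0) = ω →
        FreeElastic.length (γ 0) = 2 * ω * Real.pi →
        FreeElastic.Kosc (γ 0) ≤ ε₀ →
        ∀ t : ℝ, t₀ < t → (t : EReal) < T →
          FreeElastic.ksNormSq (γ t) ≤
            FreeElastic.ksNormSq (γ t₀) * Real.exp (-(1 / (4 * (ω : ℝ) ^ 4)) * t) := by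
  have hω1 : (1 : ℝ) ≤ ω := by exact_mod_cast hω
  set L : ℝ := 2 * ω * Real.pi with hLdef
  have hL : 1 ≤ L := by nlinarith [Real.pi_gt_three]
  have hL0 : 0 < L := zero_lt_one.trans_le hL
  set δ : ℝ := 1 / (400 * L ^ 4) with hδdef
  have hδ : 0 < δ := by positivity
  refine ⟨L * (δ ^ 2 / 2), by positivity, 0, le_rfl, fun T γ h hturn hlen hK t ht htT => ?_⟩
  have hk : FreeElastic.arcIntegral (γ 0) (FreeElastic.curvature (γ 0)) =
      FreeElastic.length (γ 0) := by
    rw [FreeElastic.turningNumber, inv_mul_eq_iff_eq_mul₀ Real.two_pi_pos.ne'] at hturn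
    rw [hturn, hlen, hLdef]
    ring
  have hmean : FreeElastic.meanCurvature (γ 0) = 1 := by
    rw [FreeElastic.meanCurvature, hk, hlen, inv_mul_cancel₀ hL0.ne']
  rw [FreeElastic.Kosc, hmean, hlen] at hK
  have hini := le_of_mul_le_mul_left hK hL0
  have hδ2 : 0 < δ ^ 2 := by positivity
  refine h.ksNormSq_le htT ht hk (by rwa [hlen]) hδ ?_ (by linarith) ?_
  · rw [hlen, hδdef, one_div_mul_cancel (by positivity)]
  · have h4 : (1 : ℝ) ≤ (ω : ℝ) ^ 4 := one_le_pow₀ hω1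
    rw [div_le_iff₀ (by positivity)]
    linarith
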